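/- Let $d\ge 1$, let $\mathbb V$ be a separable complex Hilbert space whose inner product $\langle\cdot,\cdot\rangle$ is linear in the first argument, and write $(f\otimes g)h:=\langle h,g\rangle f$. Let $\mathbb T$ be the Banach space of trace-class operators on $\mathbb V$ with the trace norm $\|\cdot\|_{\rm tr}$, and let $\mathbb T_+\subset\mathbb T$ be the positive ones. A $\mathbb T_+$-valued measure on $\mathbb R^d$ is a map $\mu:\mathcal B(\mathbb R^d)\to\mathbb T_+$ that is countably additive in the trace norm; its trace measure is the finite Borel measure $\|\mu\|_{\rm tr}(A):=\|\mu(A)\|_{\rm tr}$. All random elements are defined on one probability space; one with values in $\mathbb V$ is called second order if it has mean zero and $\mathbb E\|\cdot\|^2<\infty$, and expectations $\mathbb E[Y\otimes Z]$ are Bochner integrals in $\mathbb T$. An orthogonal $\mathbb V$-valued random measure with control measure $\mu$ is a family $\xi=\{\xi(A),A\in\mathcal B(\mathbb R^d)\}$ of second order random elements of $\mathbb V$ such that (i) $\mathbb E\|\xi(A_n)\|^2\to0$ whenever $A_n\to\emptyset$, and (ii) $\mathbb E[\xi(A)\otimes\xi(B)]=\mu(A\cap B)$ for all Borel sets $A,B$.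 For $f\in L^2(\|\mu\|_{\rm tr})$, the integral $\int f\,d\xi$ is the value at $f$ of the extension by continuity of the isometry $\sum_j c_j\mathbf 1_{A_j}\mapsto\sum_j c_j\xi(A_j)$ ($c_j\in\mathbb C$, $A_j$ disjoint Borel sets) to a map from $L^2(\|\mu\|_{\rm tr})$ to the space of $\mathbb V$-valued square-integrable random elements. **Theorem.** Let $X=\{X(t),t\in\mathbb R^d\}$ be a $\mathbb V$-valued process that is $L^2$-continuous ($\mathbb E\|X(s)-X(t)\|^2\to0$ as $s\to t$, for every $t$) and weakly stationary (each $X(t)$ is second order, and $\mathbb E[X(s)\otimes X(s+h)]$ does not depend on $s$, for every $h$). Let $\mathcal K(h):=\mathbb E[X(s+h)\otimes X(s)]$ be its stationary covariance function. Then there is a unique $\mathbb T_+$-valued measure $\mu$ on $\mathbb R^d$ with $$\mathcal K(t)=\int_{\mathbb R^d}e^{\mathbf i t^\top x}\,\mu(dx)\qquad\text{for all }t\in\mathbb R^d,$$ and there is an orthogonal $\mathbb V$-valued random measure $\xi$ with control measure $\mu$ such that $$X(t)=\int_{\mathbb R^d}e^{\mathbf i t^\top x}\,\xi(dx)\quad\text{almost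 surely, for every }t\in\mathbb R^d.$$ It is almost surely unique: if $\eta$ is another orthogonal random measure with control measure $\mu$ and this property, then $\eta(A)=\xi(A)$ almost surely, for every Borel set $A$. -/

import Mathlib

open MeasureTheory Filter Topology ContinuousLinearMap
open scoped ENNReal InnerProductSpace

namespace Cramer

variable {V : Type*} [NormedAddCommGroup V] [InnerProductSpace ℂ V] [CompleteSpace V]

/-- A complete orthonormal system of `V`. -/
noncomputable def cons (V : Type*) [NormedAddCommGroup V] [InnerProductSpace ℂ V]
    [CompleteSpace V] : HilbertBasis (exists_hilbertBasis ℂ V).choose ℂ V :=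
  (exists_hilbertBasis ℂ V).choose_spec.choose

/-- The trace norm `∑ⱼ ⟨(T*T)^{1/2} eⱼ, eⱼ⟩`, with value `∞` if `T` is not trace class. It does not
depend on the complete orthonormal system, see `traceNorm_eq`. -/
noncomputable def traceNorm (T : V →L[ℂ] V) : ℝ≥0∞ :=
  ∑' j, ENNReal.ofReal (⟪cons V j, CFC.abs T (cons V j)⟫_ℂ).re

set_option linter.unusedSectionVars false in
theorem parseval_enorm {ι : Type*} (b : HilbertBasis ι ℂ V) (x : V) :
    ∑' i, ‖⟪b i, x⟫_ℂ‖ₑ ^ 2 = ‖x‖ₑ ^ 2 := by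
  have h := b.hasSum_inner_mul_inner x x
  have h2 : HasSum (fun i => ‖⟪b i, x⟫_ℂ‖ ^ 2) (‖x‖ ^ 2) := by
    have h3 := (Complex.hasSum_re h)
    convert! h3 using 1
    · ext i
      rw [← inner_conj_symm x (b i), ← Complex.normSq_eq_conj_mul_self, Complex.ofReal_re,
        Complex.normSq_eq_norm_sq]
    · exact (inner_self_eq_norm_sq (𝕜 := ℂ) x).symm
  have h4 := congrArg ENNReal.ofReal h2.tsum_eq
  rw [ENNReal.ofReal_tsum_of_nonneg (fun i => sq_nonneg _) h2.summable] at h4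
  simpa [ENNReal.ofReal_pow, ofReal_norm] using h4

theorem hs_adjoint {ι κ : Type*} (b : HilbertBasis ι ℂ V) (c : HilbertBasis κ ℂ V)
    (R : V →L[ℂ] V) : ∑' i, ‖R (b i)‖ₑ ^ 2 = ∑' j, ‖adjoint R (c j)‖ₑ ^ 2 := by
  simp_rw [← parseval_enorm c (R _), ← parseval_enorm b (adjoint R _)]
  rw [ENNReal.tsum_comm]
  congr! 5 with j i
  rw [adjoint_inner_right, ← inner_conj_symm, ← ofReal_norm, RCLike.norm_conj, ofReal_norm]

theorem abs_apply_norm (T : V →L[ℂ] V) (x : V) : ‖CFC.abs T x‖ = ‖T x‖ := by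
  have hA : IsSelfAdjoint (CFC.abs T) := (CFC.abs_nonneg T).isSelfAdjoint
  have h : ⟪CFC.abs T x, CFC.abs T x⟫_ℂ = ⟪T x, T x⟫_ℂ := by
    rw [← adjoint_inner_right, ← adjoint_inner_right]
    have := congrArg (fun R : V →L[ℂ] V => R x) (CFC.abs_mul_abs T)
    simp only [mul_apply_eq_comp, star_eq_adjoint] at this
    rw [← star_eq_adjoint (CFC.abs T), hA.star_eq, this]
  rw [inner_self_eq_norm_sq_to_K, inner_self_eq_norm_sq_to_K] at h
  norm_cast at h
  exact (pow_left_inj₀ (norm_nonneg _) (norm_nonneg _) two_ne_zero).1 h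

theorem exists_polar (T : V →L[ℂ] V) : ∃ U : V →L[ℂ] V, ‖U‖ ≤ 1 ∧
    (∀ x, U (CFC.abs T x) = T x) ∧ ∀ x, adjoint U (T x) = CFC.abs T x := by
  set A := CFC.abs T with hA
  let M := (LinearMap.range A.toLinearMap).topologicalClosure
  have : CompleteSpace M := (Submodule.isClosed_topologicalClosure _).completeSpace_coe
  let e : V →ₗ[ℂ] M := A.toLinearMap.codRestrict M
    (fun x => Submodule.le_topologicalClosure _ ⟨x, rfl⟩)
  have he : DenseRange e := by
    intro y
    rw [Topology.IsInducing.subtypeVal.closure_eq_preimage_closure_image]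
    have := y.2
    convert! this using 1
    rw [Set.mem_preimage, ← Set.range_comp]
    rfl
  have hn : ∀ x, ‖T.toLinearMap x‖ ≤ 1 * ‖e x‖ := fun x => by
    rw [one_mul]; exact (abs_apply_norm T x).ge
  let U := (T.toLinearMap.extendOfNorm e) ∘L M.orthogonalProjectionOnto
  have hU : ‖U‖ ≤ 1 := by
    refine (opNorm_comp_le _ _).trans ?_
    have h1 := LinearMap.opNorm_extendOfNorm_le he zero_le_one hn
    have h2 := M.orthogonalProjectionOnto_norm_le
    nlinarith [norm_nonneg M.orthogonalProjectionOnto, norm_nonneg (T.toLinearMap.extendOfNorm e)]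
  have hUA : ∀ x, U (A x) = T x := fun x => by
    have : M.orthogonalProjectionOnto (A x) = e x :=
      Submodule.orthogonalProjectionOnto_mem_subspace_eq_self (K := M) (e x)
    change (T.toLinearMap.extendOfNorm e) (M.orthogonalProjectionOnto (A x)) = T x
    rw [this, LinearMap.extendOfNorm_eq he ⟨1, hn⟩]
    rfl
  refine ⟨U, hU, hUA, fun x => ?_⟩
  have h1 : ‖adjoint U (T x)‖ ≤ ‖A x‖ := by
    rw [abs_apply_norm]
    refine (le_opNorm _ _).trans ?_
    rw [LinearIsometryEquiv.norm_map]
    exact mul_le_of_le_one_left (norm_nonneg _) hU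
  have h2 : RCLike.re ⟪adjoint U (T x), A x⟫_ℂ = ‖A x‖ ^ 2 := by
    rw [adjoint_inner_left, hUA, inner_self_eq_norm_sq, abs_apply_norm]
  rw [← sub_eq_zero, ← norm_eq_zero, ← sq_eq_zero_iff]
  apply le_antisymm _ (sq_nonneg _)
  rw [norm_sub_sq (𝕜 := ℂ), h2]
  nlinarith [norm_nonneg (adjoint U (T x))]

theorem exists_root (T : V →L[ℂ] V) : ∃ S : V →L[ℂ] V, adjoint S = S ∧
    ∀ x, S (S x) = CFC.abs T x := by
  refine ⟨CFC.sqrt (CFC.abs T), ?_, fun x => ?_⟩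
  · rw [← star_eq_adjoint]
    exact (CFC.sqrt_nonneg (CFC.abs T)).isSelfAdjoint
  · rw [← mul_apply_eq_comp, CFC.sqrt_mul_sqrt_self (CFC.abs T) (CFC.abs_nonneg T)]

theorem tsum_abs_eq {ι : Type*} (b : HilbertBasis ι ℂ V) {T S : V →L[ℂ] V} (hS : adjoint S = S)
    (hSS : ∀ x, S (S x) = CFC.abs T x) :
    ∑' i, ENNReal.ofReal (⟪b i, CFC.abs T (b i)⟫_ℂ).re = ∑' i, ‖S (b i)‖ₑ ^ 2 := by
  congr! 2 with i
  rw [← hSS, ← adjoint_inner_left, hS]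
  have h : (⟪S (b i), S (b i)⟫_ℂ).re = ‖S (b i)‖ ^ 2 := inner_self_eq_norm_sq (𝕜 := ℂ) _
  rw [h, ENNReal.ofReal_pow (norm_nonneg _), ofReal_norm]

/-- The trace norm does not depend on the complete orthonormal system. -/
theorem traceNorm_eq {ι : Type*} (b : HilbertBasis ι ℂ V) (T : V →L[ℂ] V) :
    traceNorm T = ∑' i, ENNReal.ofReal (⟪b i, CFC.abs T (b i)⟫_ℂ).re := by
  obtain ⟨S, hS, hSS⟩ := exists_root T
  rw [traceNorm, tsum_abs_eq b hS hSS, tsum_abs_eq (cons V) hS hSS, hs_adjoint (cons V) b S, hS]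

theorem le_traceNorm {ι : Type*} (b : HilbertBasis ι ℂ V) (T W : V →L[ℂ] V) (hW : ‖W‖ ≤ 1) :
    ∑' i, ‖⟪W (b i), T (b i)⟫_ℂ‖ₑ ≤ traceNorm T := by
  obtain ⟨S, hS, hSS⟩ := exists_root T
  obtain ⟨U, hU, hUA, -⟩ := exists_polar T
  have hc : ∀ Q : V →L[ℂ] V, ‖Q‖ ≤ 1 → ∀ x, ‖Q x‖ₑ ≤ ‖x‖ₑ := fun Q hQ x => by
    rw [← ofReal_norm, ← ofReal_norm]
    exact ENNReal.ofReal_le_ofReal <| (Q.le_opNorm x).trans (mul_le_of_le_one_left (norm_nonneg _) hQ)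
  let Q := adjoint U ∘L W
  have hQ : ‖adjoint Q‖ ≤ 1 := by
    rw [LinearIsometryEquiv.norm_map]
    refine (opNorm_comp_le _ _).trans ?_
    rw [LinearIsometryEquiv.norm_map]
    exact mul_le_one₀ hU (norm_nonneg _) hW
  have h1 : ∑' i, ‖S (Q (b i))‖ₑ ^ 2 ≤ ∑' i, ‖S (b i)‖ₑ ^ 2 := by
    have := hs_adjoint b b (S ∘L Q)
    simp only [comp_apply] at this
    rw [this, adjoint_comp, hS]
    exact ENNReal.tsum_le_tsum fun i => by gcongr; exact hc _ hQ _
  have h2 : ∀ i, 2 * ‖⟪W (b i), T (b i)⟫_ℂ‖ₑ ≤ ‖S (Q (b i))‖ₑ ^ 2 + ‖S (b i)‖ₑ ^ 2 := by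
    intro i
    have : ⟪W (b i), T (b i)⟫_ℂ = ⟪S (Q (b i)), S (b i)⟫_ℂ := by
      rw [← hUA, ← adjoint_inner_left, ← hSS, ← adjoint_inner_left S, hS]; rfl
    rw [this]
    have h3 := norm_inner_le_norm (𝕜 := ℂ) (S (Q (b i))) (S (b i))
    simp only [enorm_eq_nnnorm]
    norm_cast
    rw [← NNReal.coe_le_coe]
    push_cast
    nlinarith [sq_nonneg (‖S (Q (b i))‖ - ‖S (b i)‖)]
  have h3 := ENNReal.tsum_le_tsum h2
  rw [ENNReal.tsum_mul_left, ENNReal.tsum_add] at h3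
  rw [traceNorm_eq b, tsum_abs_eq b hS hSS]
  have h4 : 2 * ∑' i, ‖⟪W (b i), T (b i)⟫_ℂ‖ₑ ≤ 2 * ∑' i, ‖S (b i)‖ₑ ^ 2 :=
    h3.trans (by rw [two_mul]; gcongr)
  exact (ENNReal.mul_le_mul_iff_right two_ne_zero (by simp)).1 h4

theorem exists_traceNorm_eq {ι : Type*} (b : HilbertBasis ι ℂ V) (T : V →L[ℂ] V) :
    ∃ U : V →L[ℂ] V, ‖U‖ ≤ 1 ∧ traceNorm T ≤ ∑' i, ‖⟪U (b i), T (b i)⟫_ℂ‖ₑ := by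
  obtain ⟨U, hU, -, hUA⟩ := exists_polar T
  refine ⟨U, hU, ?_⟩
  rw [traceNorm_eq b]
  refine ENNReal.tsum_le_tsum fun i => ?_
  rw [← hUA, adjoint_inner_right, ← ofReal_norm]
  exact ENNReal.ofReal_le_ofReal (Complex.re_le_norm _)

theorem traceNorm_add (S T : V →L[ℂ] V) : traceNorm (S + T) ≤ traceNorm S + traceNorm T := by
  obtain ⟨U, hU, h⟩ := exists_traceNorm_eq (cons V) (S + T)
  refine h.trans ((ENNReal.tsum_le_tsum fun i => ?_).trans
    (ENNReal.tsum_add.le.trans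
    (add_le_add (le_traceNorm (cons V) S U hU) (le_traceNorm (cons V) T U hU))))
  rw [add_apply, inner_add_right]
  exact enorm_add_le _ _

theorem traceNorm_smul (c : ℂ) (T : V →L[ℂ] V) : traceNorm (c • T) = ‖c‖ₑ * traceNorm T := by
  rw [traceNorm, traceNorm, ← ENNReal.tsum_mul_left]
  congr! 2 with i
  rw [CFC.abs_smul, smul_apply, ← ofReal_norm c, ← ENNReal.ofReal_mul (norm_nonneg _)]
  congr 1
  rw [inner_smul_right_eq_smul]
  simp

theorem opNorm_le_traceNorm (T : V →L[ℂ] V) (x : V) : ‖T x‖ₑ ≤ traceNorm T * ‖x‖ₑ := by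
  obtain ⟨S, hS, hSS⟩ := exists_root T
  have h1 : ∀ y, ‖S y‖ₑ ^ 2 ≤ traceNorm T * ‖y‖ₑ ^ 2 := fun y => by
    rw [traceNorm, tsum_abs_eq _ hS hSS, ← parseval_enorm (cons V), ← ENNReal.tsum_mul_right]
    refine ENNReal.tsum_le_tsum fun i => ?_
    rw [← mul_pow, ← adjoint_inner_left, hS]
    gcongr
    rw [← ofReal_norm, ← ofReal_norm, ← ofReal_norm, ← ENNReal.ofReal_mul (norm_nonneg _)]
    exact ENNReal.ofReal_le_ofReal (norm_inner_le_norm _ _)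
  have h2 : ‖T x‖ₑ ^ 2 ≤ (traceNorm T * ‖x‖ₑ) ^ 2 := by
    rw [← ofReal_norm (T x), ← abs_apply_norm, ofReal_norm, ← hSS]
    refine (h1 _).trans ?_
    rw [mul_pow, sq (traceNorm T), mul_assoc]
    gcongr
    exact h1 x
  exact (ENNReal.pow_le_pow_left_iff two_ne_zero).1 h2

theorem traceNorm_eq_zero {T : V →L[ℂ] V} (h : traceNorm T = 0) : T = 0 := by
  obtain ⟨S, hS, hSS⟩ := exists_root T
  rw [traceNorm, tsum_abs_eq _ hS hSS, ENNReal.tsum_eq_zero] at h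
  have hS0 : S = 0 := by
    refine ContinuousLinearMap.ext_on (s := Set.range (cons V)) ?_ ?_
    · have := (cons V).dense_span
      rw [← Submodule.dense_iff_topologicalClosure_eq_top] at this
      exact this
    · rintro _ ⟨i, rfl⟩
      simpa using h i
  ext x
  rw [zero_apply, ← norm_eq_zero, ← abs_apply_norm, ← hSS, hS0]
  simp

theorem traceNorm_rankOne_lt_top (f g : V) :
    traceNorm (InnerProductSpace.rankOne ℂ f g) < ∞ := by
  obtain ⟨U, hU, h⟩ := exists_traceNorm_eq (cons V) (InnerProductSpace.rankOne ℂ f g)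
  refine h.trans_lt ?_
  have h2 : ∀ i, ‖⟪U (cons V i), InnerProductSpace.rankOne ℂ f g (cons V i)⟫_ℂ‖ₑ ≤
      ‖⟪cons V i, g⟫_ℂ‖ₑ ^ 2 + ‖⟪cons V i, adjoint U f⟫_ℂ‖ₑ ^ 2 := fun i => by
    rw [InnerProductSpace.rankOne_apply, inner_smul_right, adjoint_inner_right,
      ← inner_conj_symm g, enorm_mul]
    simp only [enorm_eq_nnnorm]
    norm_cast
    rw [← NNReal.coe_le_coe]
    push_cast
    rw [RCLike.norm_conj]
    nlinarith [sq_nonneg (‖⟪cons V i, g⟫_ℂ‖ - ‖⟪U (cons V i), f⟫_ℂ‖),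
      sq_nonneg (‖⟪cons V i, g⟫_ℂ‖), sq_nonneg (‖⟪U (cons V i), f⟫_ℂ‖)]
  refine (ENNReal.tsum_le_tsum h2).trans_lt ?_
  rw [ENNReal.tsum_add, parseval_enorm, parseval_enorm]
  finiteness

/-- Trace-class operators on `V`, as a subspace of the bounded operators. -/
noncomputable def traceClassSubmodule (V : Type*) [NormedAddCommGroup V] [InnerProductSpace ℂ V]
    [CompleteSpace V] : Submodule ℂ (V →L[ℂ] V) where
  carrier := {T | traceNorm T < ∞}
  zero_mem' := by simp [traceNorm]
  add_mem' {S T} hS hT := (traceNorm_add S T).trans_lt (ENNReal.add_lt_top.2 ⟨hS, hT⟩)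
  smul_mem' c T hT := by
    simp only [Set.mem_ofPred_eq, traceNorm_smul] at hT ⊢
    exact ENNReal.mul_lt_top (by simp) hT

/-- The space of trace-class operators on `V`. It is a type of its own, because it carries the
trace norm and not the operator norm. -/
def TraceClass (V : Type*) [NormedAddCommGroup V] [InnerProductSpace ℂ V]
    [CompleteSpace V] : Type _ := traceClassSubmodule V

noncomputable instance : AddCommGroup (TraceClass V) :=
  inferInstanceAs (AddCommGroup (traceClassSubmodule V))

noncomputable instance : Module ℂ (TraceClass V) :=
  inferInstanceAs (Module ℂ (traceClassSubmodule V))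

namespace TraceClass

/-- The underlying bounded operator. -/
noncomputable def op : TraceClass V →ₗ[ℂ] (V →L[ℂ] V) := (traceClassSubmodule V).subtype

theorem op_injective : Function.Injective (op : TraceClass V → (V →L[ℂ] V)) :=
  Subtype.val_injective

theorem traceNorm_lt_top (T : TraceClass V) : traceNorm T.op < ∞ := T.2

/-- The trace norm. -/
noncomputable instance : Norm (TraceClass V) := ⟨fun T => (traceNorm T.op).toReal⟩

theorem norm_def (T : TraceClass V) : ‖T‖ = (traceNorm T.op).toReal := rfl

theorem core : NormedSpace.Core ℂ (TraceClass V) where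
  norm_nonneg _ := ENNReal.toReal_nonneg
  norm_smul c T := by simp [norm_def, traceNorm_smul]
  norm_triangle S T := by
    rw [norm_def, norm_def, norm_def, ← ENNReal.toReal_add S.traceNorm_lt_top.ne
      T.traceNorm_lt_top.ne, map_add]
    exact ENNReal.toReal_mono (ENNReal.add_lt_top.2 ⟨S.traceNorm_lt_top, T.traceNorm_lt_top⟩).ne
      (traceNorm_add _ _)
  norm_eq_zero_iff T := by
    refine ⟨fun h => op_injective ?_, fun h => by simp [h, norm_def, traceNorm]⟩
    rw [map_zero]
    exact traceNorm_eq_zero (((ENNReal.toReal_eq_zero_iff _).1 h).resolve_right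
      T.traceNorm_lt_top.ne)

noncomputable instance : NormedAddCommGroup (TraceClass V) := NormedAddCommGroup.ofCore core

noncomputable instance : NormedSpace ℂ (TraceClass V) := NormedSpace.ofCore core

theorem enorm_def (T : TraceClass V) : ‖T‖ₑ = traceNorm T.op := by
  rw [← ofReal_norm, norm_def, ENNReal.ofReal_toReal T.traceNorm_lt_top.ne]

theorem norm_op_le (T : TraceClass V) : ‖T.op‖ ≤ ‖T‖ := by
  refine opNorm_le_bound _ (norm_nonneg _) fun x => ?_
  have := opNorm_le_traceNorm T.op x
  rw [← enorm_def, ← ofReal_norm, ← ofReal_norm, ← ofReal_norm,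
    ← ENNReal.ofReal_mul (norm_nonneg _)] at this
  exact (ENNReal.ofReal_le_ofReal_iff (by positivity)).1 this

/-- The inclusion of the trace-class operators into the bounded operators, as a bounded map. -/
noncomputable def opL : TraceClass V →L[ℂ] (V →L[ℂ] V) :=
  LinearMap.mkContinuous op 1 fun T => by simpa using norm_op_le T

theorem opL_apply (T : TraceClass V) : opL T = T.op := rfl

/-- The trace-class operators form a Banach space, so that Bochner integrals with values in
`TraceClass V` are the genuine ones. -/
instance : CompleteSpace (TraceClass V) := by
  refine Metric.complete_of_cauchySeq_tendsto fun u hu => ?_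
  have hu' : CauchySeq fun n => (u n).op :=
    (opL (V := V)).uniformContinuous.comp_cauchySeq hu
  obtain ⟨T, hT⟩ := cauchySeq_tendsto_of_complete hu'
  have key : ∀ ε : ℝ, 0 < ε → ∃ N, ∀ n ≥ N, traceNorm (T - (u n).op) ≤ ENNReal.ofReal ε := by
    intro ε hε
    obtain ⟨N, hN⟩ := Metric.cauchySeq_iff.1 hu ε hε
    refine ⟨N, fun n hn => ?_⟩
    obtain ⟨U, hU, h⟩ := exists_traceNorm_eq (cons V) (T - (u n).op)
    refine h.trans (ENNReal.summable.tsum_le_of_sum_le fun F => ?_)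
    have hlim : Tendsto (fun m => ∑ i ∈ F, ‖⟪U (cons V i), ((u m).op - (u n).op) (cons V i)⟫_ℂ‖ₑ)
        atTop (𝓝 (∑ i ∈ F, ‖⟪U (cons V i), (T - (u n).op) (cons V i)⟫_ℂ‖ₑ)) := by
      refine tendsto_finsetSum _ fun i _ => ?_
      have h1 : Tendsto (fun m => ((u m).op - (u n).op) (cons V i)) atTop
          (𝓝 ((T - (u n).op) (cons V i))) :=
        ((apply ℂ V (cons V i)).continuous.tendsto _).comp (hT.sub_const _)
      exact (continuous_enorm.tendsto _).comp (Tendsto.inner tendsto_const_nhds h1)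
    refine le_of_tendsto hlim (eventually_atTop.2 ⟨N, fun m hm => ?_⟩)
    refine (ENNReal.sum_le_tsum F).trans ((le_traceNorm (cons V) _ U hU).trans ?_)
    rw [← map_sub, ← enorm_def, ← ofReal_norm, ← dist_eq_norm]
    exact ENNReal.ofReal_le_ofReal (hN m hm n hn).le
  have hmem : traceNorm T < ∞ := by
    obtain ⟨N, hN⟩ := key 1 one_pos
    have := traceNorm_add (T - (u N).op) (u N).op
    rw [sub_add_cancel] at this
    exact this.trans_lt (ENNReal.add_lt_top.2
      ⟨(hN N le_rfl).trans_lt ENNReal.ofReal_lt_top, (u N).traceNorm_lt_top⟩)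
  let L : TraceClass V := ⟨T, hmem⟩
  refine ⟨L, Metric.tendsto_atTop.2 fun ε hε => ?_⟩
  obtain ⟨N, hN⟩ := key (ε / 2) (half_pos hε)
  refine ⟨N, fun n hn => ?_⟩
  have h1 : ‖L - u n‖ₑ ≤ ENNReal.ofReal (ε / 2) := by
    rw [enorm_def, map_sub]; exact hN n hn
  rw [dist_comm, dist_eq_norm]
  rw [← ofReal_norm, ENNReal.ofReal_le_ofReal_iff (half_pos hε).le] at h1
  linarith

/-- The outer product `f ⊗ g`, i.e. the operator `h ↦ ⟨h, g⟩ f`, where `⟨·, ·⟩` is linear in its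
first argument (in Mathlib's notation the scalar is `⟪g, h⟫_ℂ`). -/
noncomputable def outer (f g : V) : TraceClass V :=
  ⟨InnerProductSpace.rankOne ℂ f g, traceNorm_rankOne_lt_top f g⟩

theorem outer_apply (f g h : V) : (outer f g).op h = ⟪g, h⟫_ℂ • f := rfl

end TraceClass

/-- `ℝ^d`. -/
abbrev Rd (d : ℕ) := EuclideanSpace ℝ (Fin d)

/-- A (finite) measure on the Borel sets of `ℝ^d` with values in the positive trace-class
operators: it is countably additive in the trace norm. -/
structure PosOpMeasure (d : ℕ) (V : Type*) [NormedAddCommGroup V] [InnerProductSpace ℂ V]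
    [CompleteSpace V] where
  toVectorMeasure : VectorMeasure (Rd d) (TraceClass V)
  isPositive : ∀ A, MeasurableSet A → (toVectorMeasure A).op.IsPositive

namespace PosOpMeasure

variable {d : ℕ}

theorem traceNorm_eq_of_isPositive {T : V →L[ℂ] V} (hT : T.IsPositive) :
    traceNorm T = ∑' j, ENNReal.ofReal (⟪cons V j, T (cons V j)⟫_ℂ).re := by
  rw [traceNorm, CFC.abs_of_nonneg T ((nonneg_iff_isPositive T).2 hT)]

/-- The trace measure `A ↦ ‖μ(A)‖_tr` of `μ`. -/
noncomputable def traceMeasure (μ : PosOpMeasure d V) : Measure (Rd d) :=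
  Measure.ofMeasurable (fun A _ => ‖μ.toVectorMeasure A‖ₑ) (by simp) (by
    intro A hA hd
    have hs := μ.toVectorMeasure.m_iUnion hA hd
    have hU := μ.isPositive _ (MeasurableSet.iUnion hA)
    simp_rw [TraceClass.enorm_def, traceNorm_eq_of_isPositive hU,
      fun n => traceNorm_eq_of_isPositive (μ.isPositive _ (hA n))]
    rw [ENNReal.tsum_comm]
    congr! 2 with j
    let L : TraceClass V →L[ℝ] ℝ := Complex.reCLM ∘L
      ((innerSL ℂ (cons V j) ∘L apply ℂ V (cons V j) ∘L TraceClass.opL).restrictScalars ℝ)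
    have h1 := L.hasSum hs
    exact (congrArg ENNReal.ofReal h1.tsum_eq.symm).trans (ENNReal.ofReal_tsum_of_nonneg
      (fun n => (μ.isPositive _ (hA n)).re_inner_nonneg_right _) h1.summable))

theorem traceMeasure_apply (μ : PosOpMeasure d V) {A : Set (Rd d)} (hA : MeasurableSet A) :
    μ.traceMeasure A = ‖μ.toVectorMeasure A‖ₑ :=
  Measure.ofMeasurable_apply A hA

/-- The integrability condition in `VectorMeasure.integral` is the one for the trace measure. -/
theorem variation_eq (μ : PosOpMeasure d V) : μ.toVectorMeasure.variation = μ.traceMeasure := by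
  refine le_antisymm (VectorMeasure.variation_le_of_forall_enorm_le fun A hA =>
    (μ.traceMeasure_apply hA).ge) (Measure.le_iff.2 fun A hA => ?_)
  rw [μ.traceMeasure_apply hA]
  exact VectorMeasure.enorm_measure_le_variation _ _

/-- The integral `∫ f dμ` of a complex-valued function, an element of the space of trace-class
operators. -/
noncomputable def integral (μ : PosOpMeasure d V) (f : Rd d → ℂ) : TraceClass V :=
  μ.toVectorMeasure.integral f (ContinuousLinearMap.lsmul ℝ ℂ)

end PosOpMeasure

/-- The character `x ↦ exp(i t·x)` of `ℝ^d`. -/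
noncomputable def character {d : ℕ} (t x : Rd d) : ℂ :=
  Complex.exp (Complex.I * ((∑ k, t k * x k : ℝ) : ℂ))

section Processes

variable {d : ℕ} {Ω : Type*} [MeasurableSpace Ω]

/-- A random element is second order if it has finite variance and mean zero. -/
def IsSecondOrder (P : Measure Ω) (Y : Ω → V) : Prop :=
  MemLp Y 2 P ∧ ∫ ω, Y ω ∂P = 0

/-- `E[Y ⊗ Z]`, a Bochner integral in the Banach space of trace-class operators. -/
noncomputable def crossCov (P : Measure Ω) (Y Z : Ω → V) : TraceClass V :=
  ∫ ω, TraceClass.outer (Y ω) (Z ω) ∂P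

/-- Mean-square continuity. -/
def IsL2Continuous (P : Measure Ω) (X : Rd d → Ω → V) : Prop :=
  ∀ t, Tendsto (fun s => ∫⁻ ω, ‖X s ω - X t ω‖ₑ ^ 2 ∂P) (𝓝 t) (𝓝 0)

/-- Weak stationarity: `X` is second order and `E[X(s) ⊗ X(s+h)]` does not depend on `s`. -/
def IsWeaklyStationary (P : Measure Ω) (X : Rd d → Ω → V) : Prop :=
  (∀ t, IsSecondOrder P (X t)) ∧
    ∀ s s' h, crossCov P (X s) (X (s + h)) = crossCov P (X s') (X (s' + h))

/-- The stationary covariance function `K(h) = E[X(s+h) ⊗ X(s)]` of a weakly stationary process;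
the right-hand side does not depend on `s`, and `s = 0` is taken here. In other words,
`E[X(t) ⊗ X(s)] = K(t - s)`. -/
noncomputable def stationaryCov (P : Measure Ω) (X : Rd d → Ω → V) (h : Rd d) : TraceClass V :=
  crossCov P (X h) (X 0)

/-- `ξ`, read on the Borel sets, is a `V`-valued orthogonal random measure on `ℝ^d` with control
measure `μ`. In the continuity condition, `A n → ∅` means that every point lies in only finitely
many of the sets `A n`. -/
structure IsOrthogonalRandomMeasure (P : Measure Ω) (ξ : Set (Rd d) → Ω → V)
    (μ : PosOpMeasure d V) : Prop where
  isSecondOrder : ∀ A, MeasurableSet A → IsSecondOrder P (ξ A)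
  continuity : ∀ A : ℕ → Set (Rd d), (∀ n, MeasurableSet (A n)) →
    (∀ x, ∀ᶠ n in atTop, x ∉ A n) → Tendsto (fun n => ∫⁻ ω, ‖ξ (A n) ω‖ₑ ^ 2 ∂P) atTop (𝓝 0)
  control : ∀ A B, MeasurableSet A → MeasurableSet B →
    μ.toVectorMeasure (A ∩ B) = crossCov P (ξ A) (ξ B)

/-- The stochastic integral `∑ c ξ(ψ = c)` of a simple function `ψ`; the sum is over the values
`c` of `ψ`. -/
noncomputable def simpleStochasticIntegral (ξ : Set (Rd d) → Ω → V) (ψ : SimpleFunc (Rd d) ℂ)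
    (ω : Ω) : V :=
  ∑ c ∈ ψ.range, c • ξ (ψ ⁻¹' {c}) ω

/-- `Y` is (a version of) the stochastic integral `∫ f dξ` of `f ∈ L²(‖μ‖_tr)` with respect to an
orthogonal random measure `ξ` with control measure `μ`: the value at `f` of the extension by
continuity of the isometry `ψ ↦ ∫ ψ dξ` from the simple functions in `L²(‖μ‖_tr)` to the
square-integrable random elements of `V`. -/
def IsStochasticIntegral (P : Measure Ω) (ξ : Set (Rd d) → Ω → V) (μ : PosOpMeasure d V)
    (f : Rd d → ℂ) (Y : Ω → V) : Prop :=
  MemLp f 2 μ.traceMeasure ∧ MemLp Y 2 P ∧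
    ∃ ψ : ℕ → SimpleFunc (Rd d) ℂ,
      Tendsto (fun n => ∫⁻ x, ‖ψ n x - f x‖ₑ ^ 2 ∂μ.traceMeasure) atTop (𝓝 0) ∧
      Tendsto (fun n => ∫⁻ ω, ‖simpleStochasticIntegral ξ (ψ n) ω - Y ω‖ₑ ^ 2 ∂P) atTop (𝓝 0)

end Processes

end Cramer

/-! The spectral representation reduces to a scalar one by taking traces. In the Hilbert space
`L²(P; V)` the curve `t ↦ X t` is continuous with Gram matrix `φ (t - s)`, where `φ` is the trace of
the stationary covariance. Bochner's theorem (`exists_charFun_eq`) therefore gives a finite scalar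
measure `τ` with characteristic function `φ`. The characters in `L²(τ)` have the same Gram matrix
and span a dense subspace (`dense_span_charLp`), so there is an isometry `I` from `L²(τ)` into
`L²(P; V)` taking the character at `t` to `X t` (`exists_linearIsometry_charLp`). The random measure
is `ξ A = I 1_A`.

The operator-valued structure is recovered from `B (f, g) = E[I f ⊗ I g]`, a bounded sesquilinear
map into the trace class. On characters it depends only on `s - t`, and density upgrades this to `B
(1_A, 1_A') = B (1_(A ∩ A'), 1)` (`indLp_inter_of_stationary`). So `μ A = B (1_A, 1)` is positive
and has trace norm `‖I 1_A‖² = τ A`. This makes `μ` countably additive with trace measure exactly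
`τ`, and extending from indicators to characters gives the Fourier representation of the covariance
(`exists_posOpMeasure`).

Both uniqueness claims again use density of the characters. Two candidates for `μ` give continuous
maps on `L²` of the sum of their trace measures that agree on characters. A competing `η A` has the
same inner products with the range of `I` as `I 1_A`, and the same norm, hence equals it. -/

namespace Cramer

/-! ### Bochner's theorem for scalar stationary covariances -/

section Fourier

open scoped FourierTransform

variable {E : Type*} [NormedAddCommGroup E] [InnerProductSpace ℝ E] [FiniteDimensional ℝ E]
  [MeasurableSpace E] [BorelSpace E]

theorem integrable_exp_neg_mul_sq_norm {c : ℝ} (hc : 0 < c) :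
    Integrable (fun t : E => Real.exp (-c * ‖t‖ ^ 2)) := by
  have h := (GaussianFourier.integrable_cexp_neg_mul_sq_norm_add (V := E) (b := (c : ℂ))
    (by simpa using hc) 0 0).norm
  refine h.congr (.of_forall fun t => ?_)
  simp only [Complex.norm_exp]
  congr 1
  simp [← Complex.ofReal_pow]

/-- An integrable function, continuous at the origin, whose Fourier transform is nonnegative, has
an integrable Fourier transform. -/
theorem integrable_fourier_of_nonneg {f : E → ℂ} (hf : Integrable f) (hf0 : ContinuousAt f 0)
    {p : E → ℝ} (hp : ∀ y, 0 ≤ p y) (hfp : ∀ y, 𝓕 f y = p y) : Integrable (𝓕 f) := by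
  have hcont : Continuous (𝓕 f) :=
    VectorFourier.fourierIntegral_continuous Real.continuous_fourierChar
      (by exact continuous_inner) hf
  have hpc : Continuous p := by
    have : p = fun y => (𝓕 f y).re := by ext y; simp [hfp]
    rw [this]; fun_prop
  -- Gaussian summability at the origin: moving the Fourier transform onto the Gaussian turns the
  -- integral into an average of `f` against an approximate identity.
  have hlim : Tendsto (fun c : ℝ => ∫ w, Complex.exp (-c⁻¹ * ‖w‖ ^ 2) • 𝓕 f w) atTop
      (𝓝 (f 0)) := by
    refine (Real.tendsto_integral_gaussian_smul' hf hf0).congr' ?_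
    filter_upwards [Ioi_mem_atTop 0] with c (hc : 0 < c)
    have J : Integrable (fun w : E => Complex.exp (-c⁻¹ * ‖w‖ ^ 2)) := by
      simpa using GaussianFourier.integrable_cexp_neg_mul_sq_norm_add (V := E) (b := (c : ℂ)⁻¹)
        (by simpa using hc) 0 0
    have h := VectorFourier.integral_fourierIntegral_smul_eq_flip (L := innerₗ E)
      Real.continuous_fourierChar continuous_inner J hf
    rw [flip_innerₗ] at h
    change _ = ∫ w, _ • VectorFourier.fourierIntegral Real.fourierChar volume (innerₗ E) f w
    rw [← h]
    congr with w
    change _ = (𝓕 (fun w : E => Complex.exp (-c⁻¹ * ‖w‖ ^ 2)) w) • f w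
    have h2 := fourier_gaussian_innerProductSpace (V := E) (b := (c : ℂ)⁻¹)
      (by simpa using hc) w
    rw [Complex.ofReal_inv, h2]
    congr 3
    · simp
    · simp only [zero_sub, norm_neg, div_inv_eq_mul]; ring
  have hint : ∀ c : ℝ, 0 < c → Integrable fun w => Real.exp (-c⁻¹ * ‖w‖ ^ 2) * p w := by
    intro c hc
    refine (integrable_exp_neg_mul_sq_norm (inv_pos.2 hc)).mul_bdd (c := ∫ t, ‖f t‖)
      hpc.aestronglyMeasurable (.of_forall fun y => ?_)
    have := VectorFourier.norm_fourierIntegral_le_integral_norm Real.fourierChar volume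
      (innerₗ E) f y
    change ‖𝓕 f y‖ ≤ _ at this
    rwa [hfp, Complex.norm_real] at this
  have hlim2 : Tendsto (fun n : ℕ => ∫⁻ w, ENNReal.ofReal (Real.exp (-(n : ℝ)⁻¹ * ‖w‖ ^ 2) * p w))
      atTop (𝓝 (ENNReal.ofReal (f 0).re)) := by
    refine ((ENNReal.continuous_ofReal.comp Complex.continuous_re).tendsto _ |>.comp
      (hlim.comp tendsto_natCast_atTop_atTop)).congr' ?_
    filter_upwards [Ioi_mem_atTop 0] with n (hn : 0 < n)
    have hn' : (0 : ℝ) < n := by exact_mod_cast hn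
    rw [← ofReal_integral_eq_lintegral_ofReal (hint n hn')
      (.of_forall fun w => mul_nonneg (Real.exp_pos _).le (hp w))]
    simp only [Function.comp_apply, smul_eq_mul, hfp]
    rw [← Complex.ofReal_re (∫ w, _ * p w), ← integral_complex_ofReal]
    congr 3
    ext w
    push_cast
    rfl
  -- Fatou's lemma removes the Gaussian factor; this is where nonnegativity of the transform is
  -- essential.
  have hle : ∫⁻ w, ENNReal.ofReal (p w) ≤ ENNReal.ofReal (f 0).re := by
    rw [← hlim2.liminf_eq]
    refine (lintegral_mono fun w => ?_).trans (lintegral_liminf_le' fun n =>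
      (ENNReal.continuous_ofReal.comp (by fun_prop)).aemeasurable)
    have h1 : Tendsto (fun n : ℕ => ENNReal.ofReal (Real.exp (-(n : ℝ)⁻¹ * ‖w‖ ^ 2) * p w)) atTop
        (𝓝 (ENNReal.ofReal (Real.exp (-0 * ‖w‖ ^ 2) * p w))) := by
      refine (ENNReal.continuous_ofReal.tendsto _).comp (Tendsto.mul_const _
        ((Real.continuous_exp.tendsto _).comp (Tendsto.mul_const _ (Tendsto.neg ?_))))
      exact tendsto_inv_atTop_nhds_zero_nat
    rw [h1.liminf_eq]
    simp
  refine ⟨hcont.aestronglyMeasurable, ?_⟩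
  refine lt_of_le_of_lt (le_of_eq ?_) (hle.trans_lt ENNReal.ofReal_lt_top)
  congr with w
  rw [hfp, ← ofReal_norm, Complex.norm_real, Real.norm_of_nonneg (hp w)]

variable {H : Type*} [NormedAddCommGroup H] [InnerProductSpace ℂ H] [CompleteSpace H]

/-- The Fourier transform of a Gaussian multiple of a stationary covariance is nonnegative. -/
theorem exists_fourier_gaussian_mul_eq {x : E → H} (hx : Continuous x) {φ : E → ℂ}
    (hφ : ∀ s t, ⟪x s, x t⟫_ℂ = φ (t - s)) {c : ℝ} (hc : 0 < c) (y : E) :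
    ∃ r : ℝ, 0 ≤ r ∧ 𝓕 (fun t : E => φ t * Real.exp (-c * ‖t‖ ^ 2)) y = r := by
  have hφ0 : ∀ t, φ t = ⟪x 0, x t⟫_ℂ := fun t => by rw [hφ, sub_zero]
  have hφc : Continuous φ := by
    have : φ = fun t => ⟪x 0, x t⟫_ℂ := funext hφ0
    rw [this]; fun_prop
  have hxn : ∀ t, ‖x t‖ = ‖x 0‖ := fun t => by
    have h : ⟪x t, x t⟫_ℂ = ⟪x 0, x 0⟫_ℂ := by rw [hφ, hφ, sub_self, sub_self]
    rw [inner_self_eq_norm_sq_to_K, inner_self_eq_norm_sq_to_K] at h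
    norm_cast at h
    exact (pow_left_inj₀ (norm_nonneg _) (norm_nonneg _) two_ne_zero).1 h
  have hφb : ∀ t, ‖φ t‖ ≤ ‖x 0‖ * ‖x 0‖ := fun t => by
    rw [hφ0]
    exact (norm_inner_le_norm _ _).trans_eq (by rw [hxn t])
  let e : E → ℂ := fun t => (Real.fourierChar (-⟪t, y⟫_ℝ) : ℂ)
  have hec : Continuous e := by fun_prop
  have hen : ∀ t, ‖e t‖ = 1 := fun t => Circle.norm_coe _
  have hee : ∀ s r, starRingEnd ℂ (e s) * e (s + r) = e r := fun s r => by
    simp only [e]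
    rw [inner_add_left, neg_add, AddChar.map_add_eq_mul, Circle.coe_mul, ← mul_assoc,
      ← Complex.normSq_eq_conj_mul_self, Circle.normSq_coe]
    simp
  -- The exponent `2c` is chosen so that the autocorrelation of the Gaussian factor is a constant
  -- times `exp (-c ‖r‖²)`. Hence `‖∫ g(t) x(t) dt‖²` is a positive multiple of the desired
  -- transform.
  let g : E → ℂ := fun t => e t * Real.exp (-(2 * c) * ‖t‖ ^ 2)
  have hgc : Continuous g := by fun_prop
  have hgn : ∀ t, ‖g t‖ = Real.exp (-(2 * c) * ‖t‖ ^ 2) := fun t => by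
    simp [g, hen, -Complex.ofReal_exp, abs_of_pos (Real.exp_pos _)]
  have hgi : Integrable g := by
    refine (integrable_exp_neg_mul_sq_norm (E := E) (c := 2 * c) (by positivity)).mono'
      hgc.aestronglyMeasurable (.of_forall fun t => (hgn t).le)
  have hgx : Integrable fun t => g t • x t := by
    refine (hgi.norm.mul_const ‖x 0‖).mono' (by fun_prop : Continuous _).aestronglyMeasurable
      (.of_forall fun t => ?_)
    rw [norm_smul, hxn]
  let u := ∫ t, g t • x t
  let G := ∫ s : E, Real.exp (-(4 * c) * ‖s‖ ^ 2)
  have hG : 0 < G := by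
    simp only [G]
    rw [GaussianFourier.integral_rexp_neg_mul_sq_norm (by positivity)]
    positivity
  have key : ⟪u, u⟫_ℂ = G * 𝓕 (fun t : E => φ t * Real.exp (-c * ‖t‖ ^ 2)) y := by
    have h1 : ⟪u, u⟫_ℂ = ∫ s, ∫ r, starRingEnd ℂ (g s) * g (s + r) * φ r := by
      rw [← inner_conj_symm, ← integral_inner hgx u, ← integral_conj]
      congr with s
      rw [inner_conj_symm, ← integral_inner hgx (g s • x s),
        ← integral_add_left_eq_self (fun r => ⟪g s • x s, g r • x r⟫_ℂ) s]
      congr with r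
      rw [inner_smul_left, inner_smul_right, hφ, add_sub_cancel_left]
      ring
    have h2 : ∀ s r, starRingEnd ℂ (g s) * g (s + r) * φ r =
        e r * φ r * (Real.exp (-(2 * c) * ‖s‖ ^ 2) * Real.exp (-(2 * c) * ‖s + r‖ ^ 2) : ℝ) :=
      fun s r => by
        rw [← hee s r]
        simp only [g, map_mul, Complex.conj_ofReal, Complex.ofReal_mul]
        ring
    -- A product majorant, integrable in `(s, r)`, that justifies Fubini.
    have hb : ∀ s r : E, Real.exp (-(2 * c) * ‖s‖ ^ 2) * Real.exp (-(2 * c) * ‖s + r‖ ^ 2) ≤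
        Real.exp (-c * ‖s‖ ^ 2) * Real.exp (-(c / 2) * ‖r‖ ^ 2) := fun s r => by
      rw [← Real.exp_add, ← Real.exp_add, Real.exp_le_exp]
      have h3 : ‖r‖ ≤ ‖s + r‖ + ‖s‖ := by
        simpa using norm_sub_le (s + r) s
      have h4 : ‖r‖ ^ 2 ≤ 2 * ‖s + r‖ ^ 2 + 2 * ‖s‖ ^ 2 := by
        nlinarith [norm_nonneg r, sq_nonneg (‖s + r‖ - ‖s‖)]
      nlinarith [mul_le_mul_of_nonneg_left h4 hc.le, mul_nonneg hc.le (sq_nonneg ‖s + r‖)]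
    rw [h1, integral_integral_swap]
    · have h5 : ∀ r : E, ∫ s : E, Real.exp (-(2 * c) * ‖s‖ ^ 2) *
          Real.exp (-(2 * c) * ‖s + r‖ ^ 2) =
          Real.exp (-c * ‖r‖ ^ 2) * G := fun r => by
        simp only [G]
        -- Complete the square: `2‖s‖² + 2‖s + r‖² = 4‖s + r/2‖² + ‖r‖²`.
        rw [← integral_add_right_eq_self (fun s : E => Real.exp (-(4 * c) * ‖s‖ ^ 2))
          ((1 / 2 : ℝ) • r), ← integral_const_mul]
        congr with s
        rw [← Real.exp_add, ← Real.exp_add]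
        congr 1
        have h6 : ‖s + (1 / 2 : ℝ) • r‖ ^ 2 = ‖s‖ ^ 2 + ⟪s, r⟫_ℝ + ‖r‖ ^ 2 / 4 := by
          rw [norm_add_sq_real, inner_smul_right, norm_smul]; norm_num; ring
        rw [h6, norm_add_sq_real]
        ring
      simp_rw [h2]
      simp_rw [integral_const_mul, integral_complex_ofReal, h5]
      rw [Real.fourier_eq, ← integral_const_mul]
      congr with r
      rw [Circle.smul_def]
      simp only [e, smul_eq_mul, Complex.ofReal_mul]
      ring
    · refine (((integrable_exp_neg_mul_sq_norm (E := E) hc).mul_prod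
        (integrable_exp_neg_mul_sq_norm (E := E) (half_pos hc))).const_mul
        (‖x 0‖ * ‖x 0‖)).mono'
        (by unfold Function.uncurry; fun_prop : Continuous _).aestronglyMeasurable
        (.of_forall fun ⟨s, r⟩ => ?_)
      simp only [Function.uncurry]
      rw [h2, norm_mul, norm_mul, hen, one_mul, Complex.norm_real,
        Real.norm_of_nonneg (by positivity)]
      exact mul_le_mul (hφb r) (hb s r) (by positivity) (by positivity)
  refine ⟨G⁻¹ * ‖u‖ ^ 2, by positivity, ?_⟩
  rw [inner_self_eq_norm_sq_to_K] at key
  rw [Complex.ofReal_mul, Complex.ofReal_inv, eq_inv_mul_iff_mul_eq₀ (by exact_mod_cast hG.ne'),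
    ← key]
  simp

/-- The Gaussian factor makes the function integrable. Its Fourier transform is then nonnegative and
integrable, and Fourier inversion exhibits that transform as the density of the measure, up to
scaling. -/
theorem exists_charFun_eq_mul_gaussian {x : E → H} (hx : Continuous x) {φ : E → ℂ}
    (hφ : ∀ s t, ⟪x s, x t⟫_ℂ = φ (t - s)) {c : ℝ} (hc : 0 < c) :
    ∃ ν : Measure E, IsFiniteMeasure ν ∧
      ∀ t, charFun ν t = φ t * Real.exp (-c * ‖t‖ ^ 2) := by
  have hφ0 : ∀ t, φ t = ⟪x 0, x t⟫_ℂ := fun t => by rw [hφ, sub_zero]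
  have hφc : Continuous φ := by
    have : φ = fun t => ⟪x 0, x t⟫_ℂ := funext hφ0
    rw [this]; fun_prop
  choose p hp hfp using exists_fourier_gaussian_mul_eq hx hφ hc
  set f : E → ℂ := fun t => φ t * Real.exp (-c * ‖t‖ ^ 2) with hf
  have hfc : Continuous f := by fun_prop
  have hφb : ∀ t, ‖φ t‖ ≤ ‖φ 0‖ := fun t => by
    have h : ∀ s, ‖x s‖ ^ 2 = ‖φ 0‖ := fun s => by
      rw [← sub_self s, ← hφ, inner_self_eq_norm_sq_to_K]
      simp
    rw [hφ0]
    refine (norm_inner_le_norm _ _).trans ?_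
    nlinarith [h 0, h t, sq_nonneg (‖x 0‖ - ‖x t‖)]
  have hfi : Integrable f := by
    refine ((integrable_exp_neg_mul_sq_norm (E := E) hc).const_mul ‖φ 0‖).mono'
      hfc.aestronglyMeasurable (.of_forall fun t => ?_)
    rw [hf, norm_mul, Complex.norm_real, Real.norm_of_nonneg (by positivity)]
    exact mul_le_mul_of_nonneg_right (hφb t) (by positivity)
  have hFi := integrable_fourier_of_nonneg hfi hfc.continuousAt hp hfp
  have hpi : Integrable p := by
    refine hFi.re.congr (.of_forall fun y => ?_)
    simp [hfp]
  have hpc : Continuous p := by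
    have hcont : Continuous (𝓕 f) :=
      VectorFourier.fourierIntegral_continuous Real.continuous_fourierChar
        (by exact continuous_inner) hfi
    have : p = fun y => (𝓕 f y).re := by ext y; simp [hfp]
    rw [this]; fun_prop
  let ν₀ : Measure E := volume.withDensity fun y => ENNReal.ofReal (p y)
  have hν₀ : IsFiniteMeasure ν₀ := isFiniteMeasure_withDensity_ofReal hpi.2
  -- Dilation by `2π` passes from the normalisation of `𝓕` to that of `charFun`.
  refine ⟨ν₀.map fun y => (2 * Real.pi) • y, inferInstance, fun t => ?_⟩
  rw [charFun_map_smul, charFun_apply, integral_withDensity_eq_integral_toReal_smul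
    (f := fun y => ENNReal.ofReal (p y)) hpc.measurable.ennreal_ofReal
    (.of_forall fun _ => ENNReal.ofReal_lt_top)]
  have h1 := congrFun (hfc.fourierInv_fourier_eq hfi hFi) t
  rw [Real.fourierInv_eq'] at h1
  change _ = f t
  rw [← h1]
  congr with y
  rw [ENNReal.toReal_ofReal (hp y), hfp, inner_smul_right, smul_eq_mul, mul_comm,
    Complex.real_smul, mul_comm]

/-- **Bochner's theorem** for the covariance of a stationary curve in a Hilbert space. -/
theorem exists_charFun_eq {x : E → H} (hx : Continuous x) {φ : E → ℂ}
    (hφ : ∀ s t, ⟪x s, x t⟫_ℂ = φ (t - s)) :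
    ∃ τ : Measure E, IsFiniteMeasure τ ∧ ∀ t, charFun τ t = φ t := by
  have hφ0 : ∀ t, φ t = ⟪x 0, x t⟫_ℂ := fun t => by rw [hφ, sub_zero]
  have hφc : Continuous φ := by
    have : φ = fun t => ⟪x 0, x t⟫_ℂ := funext hφ0
    rw [this]; fun_prop
  -- The total mass is `‖x 0‖²`. It must be nonzero to normalise to probability measures, for which
  -- the compactness results are stated.
  rcases eq_or_ne (x 0) 0 with h0 | h0
  · exact ⟨0, inferInstance, fun t => by rw [hφ0, h0]; simp⟩
  set M : ℝ := ‖x 0‖ ^ 2 with hM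
  have hMpos : 0 < M := by positivity
  have hMC : (M : ℂ) ≠ 0 := by exact_mod_cast hMpos.ne'
  have hφM : φ 0 = M := by
    rw [hφ0, inner_self_eq_norm_sq_to_K, hM]; simp
  choose ν hν hνφ using fun n : ℕ =>
    exists_charFun_eq_mul_gaussian hx hφ (c := ((n : ℝ) + 1)⁻¹) (by positivity)
  have hsmul : ∀ (κ : Measure E) (m : ℝ), 0 < m → ∀ t,
      charFun (ENNReal.ofReal m • κ) t = m * charFun κ t := fun κ m hm t => by
    rw [charFun_apply, integral_smul_measure, ENNReal.toReal_ofReal hm.le, charFun_apply,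
      Complex.real_smul]
  let ρ : ℕ → Measure E := fun n => ENNReal.ofReal M⁻¹ • ν n
  have hρφ : ∀ n t, charFun (ρ n) t = (M : ℂ)⁻¹ * (φ t * Real.exp (-((n : ℝ) + 1)⁻¹ * ‖t‖ ^ 2)) :=
    fun n t => by rw [hsmul _ _ (by positivity), hνφ, Complex.ofReal_inv]
  have hρ : ∀ n, IsProbabilityMeasure (ρ n) := fun n => by
    have h1 := hρφ n 0
    rw [charFun_zero, hφM] at h1
    simp only [norm_zero, ne_eq, OfNat.ofNat_ne_zero, not_false_eq_true, zero_pow, mul_zero,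
      Real.exp_zero, Complex.ofReal_one, mul_one] at h1
    rw [inv_mul_cancel₀ hMC] at h1
    have h2 : (ρ n).real Set.univ = 1 := by exact_mod_cast h1
    refine ⟨?_⟩
    rw [Measure.real, ENNReal.toReal_eq_one_iff] at h2
    exact h2
  have hlim : ∀ t, Tendsto (fun n => charFun (ρ n) t) atTop (𝓝 ((M : ℂ)⁻¹ * φ t)) := fun t => by
    simp_rw [hρφ]
    have h1 : Tendsto (fun n : ℕ => Real.exp (-((n : ℝ) + 1)⁻¹ * ‖t‖ ^ 2)) atTop
        (𝓝 (Real.exp (-0 * ‖t‖ ^ 2))) := by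
      refine (Real.continuous_exp.tendsto _).comp (Tendsto.mul_const _ (Tendsto.neg ?_))
      simpa using tendsto_one_div_add_atTop_nhds_zero_nat (𝕜 := ℝ)
    simpa using ((((Complex.continuous_ofReal.tendsto _).comp h1).const_mul (φ t)).const_mul
      (M : ℂ)⁻¹)
  -- As in Lévy's theorem, a pointwise limit of characteristic functions that is continuous forces
  -- tightness; Prokhorov's theorem then gives compactness.
  have htight := isTightMeasureSet_of_tendsto_charFun (f := fun t => (M : ℂ)⁻¹ * φ t)
    (by fun_prop) hlim
  let ρ' : ℕ → ProbabilityMeasure E := fun n => ⟨ρ n, hρ n⟩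
  have hcomp : IsCompact (closure (Set.range ρ')) := by
    refine isCompact_closure_of_isTightMeasureSet ?_
    convert! htight using 1
    ext κ
    exact ⟨fun ⟨_, ⟨n, rfl⟩, h⟩ => ⟨n, h⟩, fun ⟨n, h⟩ => ⟨_, ⟨n, rfl⟩, h⟩⟩
  -- A limit along a nonprincipal ultrafilter replaces the extraction of a subsequence.
  -- Characteristic functions already converge along `atTop`, so their limit is unaffected.
  obtain ⟨μ, -, hμ⟩ := hcomp.ultrafilter_le_nhds ((hyperfilter ℕ : Ultrafilter ℕ).map ρ')
    (by
      rw [le_principal_iff]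
      exact mem_of_superset (Filter.range_mem_map) subset_closure)
  have hμ' : Tendsto ρ' (hyperfilter ℕ : Filter ℕ) (𝓝 μ) := hμ
  refine ⟨ENNReal.ofReal M • (μ : Measure E),
    Measure.smul_finite _ ENNReal.ofReal_ne_top, fun t => ?_⟩
  rw [hsmul _ _ hMpos]
  rw [ProbabilityMeasure.tendsto_iff_forall_integral_rclike_tendsto ℂ] at hμ'
  have h2 := hμ' (BoundedContinuousFunction.innerProbChar t)
  simp_rw [← charFun_eq_integral_innerProbChar] at h2
  have h3 := tendsto_nhds_unique h2
    ((hlim t).mono_left (Nat.hyperfilter_le_atTop))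
  rw [h3, mul_inv_cancel_left₀ hMC]

end Fourier

end Cramer

/-! ### Outer products, the trace and operator-valued covariances -/

namespace Cramer

variable {V : Type*} [NormedAddCommGroup V] [InnerProductSpace ℂ V] [CompleteSpace V]

namespace TraceClass

theorem outer_add_left (f f' g : V) : outer (f + f') g = outer f g + outer f' g :=
  op_injective <| ContinuousLinearMap.ext fun h => by
    simp [outer_apply, smul_add]

theorem outer_add_right (f g g' : V) : outer f (g + g') = outer f g + outer f g' :=
  op_injective <| ContinuousLinearMap.ext fun h => by
    simp [outer_apply, add_smul]

theorem outer_smul_left (c : ℂ) (f g : V) : outer (c • f) g = c • outer f g :=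
  op_injective <| ContinuousLinearMap.ext fun h => by
    simp [outer_apply, smul_smul, mul_comm]

theorem outer_smul_right (c : ℂ) (f g : V) : outer f (c • g) = starRingEnd ℂ c • outer f g :=
  op_injective <| ContinuousLinearMap.ext fun h => by
    simp [outer_apply, smul_smul, mul_comm]

/-- For unit vectors, `2ab ≤ a² + b²` and Parseval give the sharp constant; sesquilinearity then
rescales to the general case. -/
theorem norm_outer_le (f g : V) : ‖outer f g‖ ≤ ‖f‖ * ‖g‖ := by
  have hsmul : ∀ (a b : ℝ) (f g : V),
      outer ((a : ℂ) • f) ((b : ℂ) • g) = ((a * b : ℝ) : ℂ) • outer f g := fun a b f g => by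
    rw [outer_smul_left, outer_smul_right, smul_smul, Complex.conj_ofReal, Complex.ofReal_mul]
  have hunit : ∀ f g : V, ‖f‖ = 1 → ‖g‖ = 1 → ‖outer f g‖ ≤ 1 := fun f g hf hg => by
    obtain ⟨U, hU, h⟩ := exists_traceNorm_eq (cons V) (InnerProductSpace.rankOne ℂ f g)
    have h2 : ∀ i, 2 * ‖⟪U (cons V i), InnerProductSpace.rankOne ℂ f g (cons V i)⟫_ℂ‖ₑ ≤
        ‖⟪cons V i, g⟫_ℂ‖ₑ ^ 2 + ‖⟪cons V i, adjoint U f⟫_ℂ‖ₑ ^ 2 := fun i => by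
      rw [InnerProductSpace.rankOne_apply, inner_smul_right, adjoint_inner_right,
        ← inner_conj_symm g, enorm_mul]
      simp only [enorm_eq_nnnorm]
      norm_cast
      rw [← NNReal.coe_le_coe]
      push_cast
      rw [RCLike.norm_conj]
      nlinarith [sq_nonneg (‖⟪cons V i, g⟫_ℂ‖ - ‖⟪U (cons V i), f⟫_ℂ‖)]
    have hUf : ‖adjoint U f‖ ≤ 1 := by
      refine (le_opNorm _ _).trans ?_
      rw [LinearIsometryEquiv.norm_map, hf, mul_one]
      exact hU
    have h3 : 2 * traceNorm (InnerProductSpace.rankOne ℂ f g) ≤ 2 * 1 := by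
      refine (mul_le_mul_right h 2).trans ?_
      rw [← ENNReal.tsum_mul_left]
      refine (ENNReal.tsum_le_tsum h2).trans ?_
      rw [ENNReal.tsum_add, parseval_enorm, parseval_enorm, ← ofReal_norm, ← ofReal_norm, hg,
        mul_one]
      nth_rw 3 [← one_add_one_eq_two]
      refine add_le_add ?_ (pow_le_one₀ zero_le ?_)
      · simp
      simpa using ENNReal.ofReal_le_ofReal hUf
    have h4 := (ENNReal.mul_le_mul_iff_right two_ne_zero (by simp)).1 h3
    exact ENNReal.toReal_mono ENNReal.one_ne_top h4
  rcases eq_or_ne f 0 with rfl | hf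
  · have : outer (0 : V) g = 0 := by simpa using hsmul 0 1 0 g
    simp [this]
  rcases eq_or_ne g 0 with rfl | hg
  · have : outer f (0 : V) = 0 := by simpa using hsmul 1 0 f 0
    simp [this]
  have hf' := norm_ne_zero_iff.2 hf
  have hg' := norm_ne_zero_iff.2 hg
  have h := hsmul ‖f‖ ‖g‖ (((‖f‖ : ℂ)⁻¹) • f) (((‖g‖ : ℂ)⁻¹) • g)
  rw [smul_inv_smul₀ (by exact_mod_cast hf'), smul_inv_smul₀ (by exact_mod_cast hg')] at h
  rw [h, norm_smul, Complex.norm_real, Real.norm_of_nonneg (by positivity)]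
  refine mul_le_of_le_one_right (by positivity) (hunit _ _ ?_ ?_)
  · rw [norm_smul, norm_inv, Complex.norm_real, norm_norm, inv_mul_cancel₀ hf']
  · rw [norm_smul, norm_inv, Complex.norm_real, norm_norm, inv_mul_cancel₀ hg']

theorem continuous_outer : Continuous fun p : V × V => outer p.1 p.2 := by
  refine continuous_iff_continuousAt.2 fun a => tendsto_iff_norm_sub_tendsto_zero.2 ?_
  have h : Tendsto (fun p : V × V => ‖p.1 - a.1‖ * ‖p.2‖ + ‖a.1‖ * ‖p.2 - a.2‖) (𝓝 a)
      (𝓝 (‖a.1 - a.1‖ * ‖a.2‖ + ‖a.1‖ * ‖a.2 - a.2‖)) :=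
    Continuous.tendsto (by fun_prop) a
  simp only [sub_self, norm_zero, zero_mul, mul_zero, add_zero] at h
  refine squeeze_zero (fun _ => norm_nonneg _) (fun p => ?_) h
  have h2 : outer p.1 p.2 - outer a.1 a.2 = outer (p.1 - a.1) p.2 + outer a.1 (p.2 - a.2) := by
    have h3 := outer_add_left (p.1 - a.1) a.1 p.2
    have h4 := outer_add_right a.1 (p.2 - a.2) a.2
    rw [sub_add_cancel] at h3 h4
    rw [h3, h4]
    abel
  rw [h2]
  exact (norm_add_le _ _).trans (add_le_add (norm_outer_le _ _) (norm_outer_le _ _))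

theorem summable_inner_op (T : TraceClass V) :
    Summable fun i => ‖⟪cons V i, T.op (cons V i)⟫_ℂ‖ := by
  have h := (le_traceNorm (cons V) T.op 1 (norm_id_le)).trans_lt T.traceNorm_lt_top
  simpa using ENNReal.summable_toReal h.ne

variable (V) in
/-- The trace. -/
noncomputable def trace : TraceClass V →L[ℂ] ℂ :=
  LinearMap.mkContinuous
    { toFun := fun T => ∑' i, ⟪cons V i, T.op (cons V i)⟫_ℂ
      map_add' := fun S T => by
        rw [← S.summable_inner_op.of_norm.tsum_add T.summable_inner_op.of_norm]
        simp
      map_smul' := fun c T => by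
        simp [tsum_mul_left] } 1 fun T => by
      rw [one_mul, norm_def]
      refine (norm_tsum_le_tsum_norm T.summable_inner_op).trans ?_
      have h := le_traceNorm (cons V) T.op 1 (norm_id_le)
      have h2 := ENNReal.toReal_mono T.traceNorm_lt_top.ne h
      rw [ENNReal.tsum_toReal_eq (by simp)] at h2
      simpa using h2

theorem trace_apply (T : TraceClass V) : trace V T = ∑' i, ⟪cons V i, T.op (cons V i)⟫_ℂ := rfl

theorem trace_outer (f g : V) : trace V (outer f g) = ⟪g, f⟫_ℂ := by
  rw [trace_apply, ← (cons V).tsum_inner_mul_inner g f]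
  simp [outer_apply]

/-- A positive operator is its own absolute value, so the trace and the trace norm are the same
series of nonnegative diagonal entries. -/
theorem trace_of_isPositive {T : TraceClass V} (hT : T.op.IsPositive) :
    trace V T = (‖T‖ : ℂ) := by
  have h0 : ∀ i, 0 ≤ (⟪cons V i, T.op (cons V i)⟫_ℂ).re := fun i =>
    hT.re_inner_nonneg_right _
  have hr : ∀ i, (((⟪cons V i, T.op (cons V i)⟫_ℂ).re : ℝ) : ℂ) =
      ⟪cons V i, T.op (cons V i)⟫_ℂ := fun i => by
    have := hT.inner_nonneg_right (cons V i)
    rw [Complex.nonneg_iff] at this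
    exact Complex.ext rfl this.2
  rw [norm_def, PosOpMeasure.traceNorm_eq_of_isPositive hT, ENNReal.tsum_toReal_eq (by simp),
    Complex.ofReal_tsum, trace_apply]
  congr with i
  rw [ENNReal.toReal_ofReal (h0 i), hr]

/-- The matrix entry `T ↦ ⟨v, T w⟩`. -/
noncomputable def entry (v w : V) : TraceClass V →L[ℂ] ℂ :=
  innerSL ℂ v ∘L apply ℂ V w ∘L opL

theorem entry_apply (v w : V) (T : TraceClass V) : entry v w T = ⟪v, T.op w⟫_ℂ := rfl

end TraceClass

open TraceClass

section CrossCov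

variable {Ω : Type*} [MeasurableSpace Ω] {P : Measure Ω}

theorem integrable_outer {Y Z : Ω → V} (hY : MemLp Y 2 P) (hZ : MemLp Z 2 P) :
    Integrable (fun ω => outer (Y ω) (Z ω)) P := by
  have h1 : Integrable (fun ω => ‖Y ω‖ * ‖Z ω‖) P := hY.norm.integrable_mul hZ.norm
  have h2 : AEStronglyMeasurable (fun ω => outer (Y ω) (Z ω)) P :=
    Continuous.comp_aestronglyMeasurable (g := fun p : V × V => outer p.1 p.2)
      (f := fun ω => (Y ω, Z ω)) continuous_outer (hY.1.prodMk hZ.1)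
  refine h1.mono' h2 ?_
  exact .of_forall fun ω => norm_outer_le (Y ω) (Z ω)

theorem crossCov_congr {Y Y' Z Z' : Ω → V} (hY : Y =ᵐ[P] Y') (hZ : Z =ᵐ[P] Z') :
    crossCov P Y Z = crossCov P Y' Z' :=
  integral_congr_ae <| by filter_upwards [hY, hZ] with ω h h'; rw [h, h']

theorem norm_crossCov_le (Y Z : Lp V 2 P) : ‖crossCov P Y Z‖ ≤ ‖Y‖ * ‖Z‖ := by
  have h1 := eLpNorm_le_eLpNorm_mul_eLpNorm'_of_norm (p := 2) (q := 2) (r := 1)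
    (Lp.aestronglyMeasurable Y) (Lp.aestronglyMeasurable Z) outer 1 (.of_forall fun ω => by
      simpa using norm_outer_le (Y ω) (Z ω))
  have h2 : ‖crossCov P Y Z‖ₑ ≤ ‖Y‖ₑ * ‖Z‖ₑ := by
    refine (enorm_integral_le_lintegral_enorm _).trans ?_
    rw [← eLpNorm_one_eq_lintegral_enorm]
    simpa [Lp.enorm_def] using h1
  rw [← ofReal_norm, ← ofReal_norm, ← ofReal_norm, ← ENNReal.ofReal_mul (norm_nonneg _)] at h2
  exact (ENNReal.ofReal_le_ofReal_iff (by positivity)).1 h2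

variable (P V) in
/-- The cross-covariance as a continuous sesquilinear map on `L²`. -/
noncomputable def crossCovL : Lp V 2 P →L[ℂ] Lp V 2 P →L⋆[ℂ] TraceClass V :=
  LinearMap.mkContinuous₂ (LinearMap.mk₂'ₛₗ (RingHom.id ℂ) (starRingEnd ℂ)
    (fun Y Z : Lp V 2 P => crossCov P Y Z)
    (fun Y Y' Z => by
      rw [crossCov_congr (Lp.coeFn_add Y Y') .rfl]
      simp only [crossCov, Pi.add_apply, outer_add_left]
      exact integral_add (integrable_outer (Lp.memLp Y) (Lp.memLp Z))
        (integrable_outer (Lp.memLp Y') (Lp.memLp Z)))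
    (fun c Y Z => by
      rw [crossCov_congr (Lp.coeFn_smul c Y) .rfl]
      simp only [crossCov, Pi.smul_apply, outer_smul_left]
      exact integral_smul _ _)
    (fun Y Z Z' => by
      rw [crossCov_congr .rfl (Lp.coeFn_add Z Z')]
      simp only [crossCov, Pi.add_apply, outer_add_right]
      exact integral_add (integrable_outer (Lp.memLp Y) (Lp.memLp Z))
        (integrable_outer (Lp.memLp Y) (Lp.memLp Z')))
    (fun c Y Z => by
      rw [crossCov_congr .rfl (Lp.coeFn_smul c Z)]
      simp only [crossCov, Pi.smul_apply, outer_smul_right]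
      exact integral_smul _ _)) 1 fun Y Z => by
      simpa using norm_crossCov_le Y Z

theorem crossCovL_apply (Y Z : Lp V 2 P) : crossCovL V P Y Z = crossCov P Y Z := rfl

theorem crossCovL_toLp {Y Z : Ω → V} (hY : MemLp Y 2 P) (hZ : MemLp Z 2 P) :
    crossCovL V P (hY.toLp Y) (hZ.toLp Z) = crossCov P Y Z :=
  crossCov_congr hY.coeFn_toLp hZ.coeFn_toLp

/-- The bridge from operator covariances to Hilbert space geometry. The arguments swap because `⟪·,
·⟫_ℂ` is conjugate-linear in its first slot. -/
theorem trace_crossCovL (Y Z : Lp V 2 P) : trace V (crossCovL V P Y Z) = ⟪Z, Y⟫_ℂ := by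
  rw [crossCovL_apply, crossCov, ← (trace V).integral_comp_comm
    (integrable_outer (Lp.memLp Y) (Lp.memLp Z)), L2.inner_def]
  simp_rw [trace_outer]

theorem isPositive_crossCov {Y : Ω → V} (hY : MemLp Y 2 P) : (crossCov P Y Y).op.IsPositive := by
  rw [isPositive_iff_complex]
  intro v
  have h : ⟪(crossCov P Y Y).op v, v⟫_ℂ = ((∫ ω, ‖⟪v, Y ω⟫_ℂ‖ ^ 2 ∂P : ℝ) : ℂ) := by
    rw [← inner_conj_symm, ← entry_apply, crossCov,
      ← (entry v v).integral_comp_comm (integrable_outer hY hY), ← integral_complex_ofReal,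
      ← integral_conj]
    congr with ω
    rw [entry_apply, outer_apply, inner_smul_right, ← inner_conj_symm,
      ← Complex.normSq_eq_conj_mul_self]
    simp [Complex.normSq_eq_norm_sq]
  rw [h]
  exact ⟨by simp, by simpa using integral_nonneg fun ω => sq_nonneg _⟩

/-- By positivity the trace norm is the trace. This equality later identifies the trace measure with
the scalar spectral measure. -/
theorem norm_crossCovL_self (Y : Lp V 2 P) : ‖crossCovL V P Y Y‖ = ‖Y‖ ^ 2 := by
  have h := trace_of_isPositive (isPositive_crossCov (Lp.memLp Y))
  rw [← crossCovL_apply, trace_crossCovL, inner_self_eq_norm_sq_to_K] at h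
  apply Complex.ofReal_injective
  rw [← h]
  simp

end CrossCov

end Cramer

/-! ### Characters and indicators in `L²` of a finite measure -/

namespace Cramer

variable {d : ℕ}

theorem character_eq (t x : Rd d) : character t x = Complex.exp (⟪x, t⟫_ℝ * Complex.I) := by
  rw [character, mul_comm]
  simp [PiLp.inner_apply]

@[fun_prop]
theorem continuous_character (t : Rd d) : Continuous (character t) := by
  unfold character
  fun_prop

theorem norm_character (t x : Rd d) : ‖character t x‖ = 1 := by
  rw [character_eq, Complex.norm_exp_ofReal_mul_I]

theorem character_add (s t x : Rd d) : character (s + t) x = character s x * character t x := by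
  rw [character_eq, character_eq, character_eq, ← Complex.exp_add, inner_add_right]
  push_cast
  ring_nf

theorem conj_character (t x : Rd d) : starRingEnd ℂ (character t x) = character (-t) x := by
  rw [character_eq, character_eq, ← Complex.exp_conj]
  simp

theorem charFun_eq_integral_character (τ : Measure (Rd d)) (t : Rd d) :
    charFun τ t = ∫ x, character t x ∂τ := by
  simp_rw [charFun_apply, character_eq]

variable (τ : Measure (Rd d)) [IsFiniteMeasure τ]

theorem memLp_character (p : ℝ≥0∞) (t : Rd d) : MemLp (character t) p τ :=
  .of_bound (continuous_character t).aestronglyMeasurable 1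
    (.of_forall fun x => (norm_character t x).le)

omit [IsFiniteMeasure τ] in
variable {τ} in
-- The positive and negative parts of `g` are densities of finite measures with the same
-- characteristic function, so they agree almost everywhere; at each point at least one of them
-- vanishes.
theorem ae_eq_zero_of_forall_integral_ofReal_mul_character {g : Rd d → ℝ} (hg : Integrable g τ)
    (h : ∀ t, ∫ x, (g x : ℂ) * character t x ∂τ = 0) : g =ᵐ[τ] 0 := by
  have hfin : ∀ f : Rd d → ℝ, Integrable f τ →
      IsFiniteMeasure (τ.withDensity fun x => ENNReal.ofReal (f x)) := fun f hf =>
    isFiniteMeasure_withDensity_ofReal hf.2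
  have hg' : Integrable (fun x => -g x) τ := hg.neg
  have := hfin g hg
  have := hfin _ hg'
  have hchar : ∀ f : Rd d → ℝ, Integrable f τ → ∀ t,
      charFun (τ.withDensity fun x => ENNReal.ofReal (f x)) t =
        ∫ x, ((max (f x) 0 : ℝ) : ℂ) * character t x ∂τ := fun f hf t => by
    rw [charFun_eq_integral_character, integral_withDensity_eq_integral_toReal_smul₀
      hf.1.aemeasurable.ennreal_ofReal (.of_forall fun _ => ENNReal.ofReal_lt_top)]
    simp_rw [ENNReal.toReal_ofReal', Complex.real_smul]
  have hint : ∀ f : Rd d → ℝ, Integrable f τ → ∀ t,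
      Integrable (fun x => ((max (f x) 0 : ℝ) : ℂ) * character t x) τ := fun f hf t =>
    hf.pos_part.ofReal.mul_bdd (c := 1) (continuous_character t).aestronglyMeasurable
      (.of_forall fun x => (norm_character t x).le)
  have heq : (τ.withDensity fun x => ENNReal.ofReal (g x)) =
      τ.withDensity fun x => ENNReal.ofReal (-g x) := by
    refine Measure.ext_of_charFun (funext fun t => ?_)
    rw [hchar g hg, hchar _ hg', ← sub_eq_zero,
      ← integral_sub (hint g hg t) (hint _ hg' t), ← h t]
    congr with x
    rw [← sub_mul, ← Complex.ofReal_sub]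
    congr 2
    rcases le_total (g x) 0 with h0 | h0
    · rw [max_eq_right h0, max_eq_left (by simpa using h0)]; ring
    · rw [max_eq_left h0, max_eq_right (by simpa using h0)]; ring
  rw [withDensity_eq_iff hg.1.aemeasurable.ennreal_ofReal hg'.1.aemeasurable.ennreal_ofReal
    (hg.lintegral_lt_top).ne] at heq
  filter_upwards [heq] with x hx
  rcases le_total (g x) 0 with h0 | h0
  · rw [ENNReal.ofReal_of_nonpos h0, eq_comm, ENNReal.ofReal_eq_zero] at hx
    exact le_antisymm h0 (by simpa using hx)
  · rw [ENNReal.ofReal_of_nonpos (by simpa using h0 : -g x ≤ 0), ENNReal.ofReal_eq_zero] at hx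
    exact le_antisymm hx h0

omit [IsFiniteMeasure τ] in
variable {τ} in
/-- An integrable function all of whose Fourier coefficients vanish is zero. -/
theorem ae_eq_zero_of_forall_integral_mul_character {f : Rd d → ℂ} (hf : Integrable f τ)
    (h : ∀ t, ∫ x, f x * character t x ∂τ = 0) : f =ᵐ[τ] 0 := by
  have hi : ∀ {f : Rd d → ℂ}, Integrable f τ → ∀ t, Integrable (fun x => f x * character t x) τ :=
    fun hf t => hf.mul_bdd (c := 1) (continuous_character t).aestronglyMeasurable
      (.of_forall fun x => (norm_character t x).le)
  have hfc : Integrable (fun x => starRingEnd ℂ (f x)) τ :=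
    Complex.conjLIE.toContinuousLinearEquiv.toContinuousLinearMap.integrable_comp hf
  -- Conjugating a character negates its frequency, so the conjugate of `f` satisfies the same
  -- hypothesis, and hence so do its real and imaginary parts.
  have h' : ∀ t, ∫ x, starRingEnd ℂ (f x) * character t x ∂τ = 0 := fun t => by
    rw [← (starRingEnd ℂ).map_zero, ← h (-t), ← integral_conj]
    congr with x
    rw [map_mul, conj_character, neg_neg]
  have hre := ae_eq_zero_of_forall_integral_ofReal_mul_character (g := fun x => (f x).re) hf.re
    fun t => by
      have h1 : (fun x => ((f x).re : ℂ) * character t x) = fun x =>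
          (1 / 2 : ℂ) * (f x * character t x + starRingEnd ℂ (f x) * character t x) := by
        ext x
        rw [Complex.re_eq_add_conj]
        ring
      rw [h1, integral_const_mul, integral_add (hi hf t) (hi hfc t), h, h']
      simp
  have him := ae_eq_zero_of_forall_integral_ofReal_mul_character (g := fun x => (f x).im) hf.im
    fun t => by
      have h1 : (fun x => ((f x).im : ℂ) * character t x) = fun x =>
          (1 / (2 * Complex.I) : ℂ) *
            (f x * character t x - starRingEnd ℂ (f x) * character t x) := by
        ext x
        rw [Complex.im_eq_sub_conj]
        ring
      rw [h1, integral_const_mul, integral_sub (hi hf t) (hi hfc t), h, h']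
      simp
  filter_upwards [hre, him] with x h1 h2
  exact Complex.ext h1 h2

/-- The character `x ↦ exp(i t·x)` as an element of `L²`. -/
noncomputable def charLp (t : Rd d) : Lp ℂ 2 τ := (memLp_character τ 2 t).toLp _

theorem coeFn_charLp (t : Rd d) : charLp τ t =ᵐ[τ] character t := MemLp.coeFn_toLp _

theorem inner_charLp (s t : Rd d) : ⟪charLp τ s, charLp τ t⟫_ℂ = charFun τ (t - s) := by
  rw [L2.inner_def, charFun_eq_integral_character]
  refine integral_congr_ae ?_
  filter_upwards [coeFn_charLp τ s, coeFn_charLp τ t] with x hs ht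
  rw [hs, ht, RCLike.inner_apply, conj_character, sub_eq_add_neg, character_add]

theorem dense_span_charLp :
    Dense (Submodule.span ℂ (Set.range (charLp τ)) : Set (Lp ℂ 2 τ)) := by
  rw [Submodule.dense_iff_topologicalClosure_eq_top, Submodule.topologicalClosure_eq_top_iff,
    Submodule.eq_bot_iff]
  intro f hf
  have h : ∀ t, ∫ x, f x * character t x ∂τ = 0 := fun t => by
    have h1 := hf (charLp τ (-t)) (Submodule.subset_span ⟨-t, rfl⟩)
    rw [L2.inner_def] at h1
    rw [← h1]
    refine integral_congr_ae ?_
    filter_upwards [coeFn_charLp τ (-t)] with x hx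
    rw [hx, RCLike.inner_apply, conj_character, neg_neg]
  have := ae_eq_zero_of_forall_integral_mul_character
    ((Lp.memLp f).integrable (by norm_num)) h
  exact (Lp.eq_zero_iff_ae_eq_zero).2 this

variable {τ}

/-- Stated for semilinear maps so as to cover both slots of a sesquilinear map. -/
theorem ext_charLp {Z : Type*} [NormedAddCommGroup Z] [NormedSpace ℂ Z] {σ : ℂ →+* ℂ}
    {F G : Lp ℂ 2 τ →SL[σ] Z} (h : ∀ t, F (charLp τ t) = G (charLp τ t)) : F = G :=
  ContinuousLinearMap.ext_on (dense_span_charLp τ) (by rintro _ ⟨t, rfl⟩; exact h t)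

/-- A curve with the same Gram matrix as the characters is their image under an isometry. -/
theorem exists_linearIsometry_charLp {H : Type*} [NormedAddCommGroup H] [InnerProductSpace ℂ H]
    [CompleteSpace H] {x : Rd d → H} (hx : ∀ s t, ⟪x s, x t⟫_ℂ = charFun τ (t - s)) :
    ∃ I : Lp ℂ 2 τ →ₗᵢ[ℂ] H, ∀ t, I (charLp τ t) = x t := by
  let e := Finsupp.linearCombination ℂ (charLp τ)
  let f := Finsupp.linearCombination ℂ x
  -- Equal Gram matrices give equal norms of formal combinations, so the map is well defined even
  -- where characters become linearly dependent in `L²(τ)`.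
  have hnorm : ∀ c, ‖f c‖ = ‖e c‖ := fun c => by
    have h : ⟪f c, f c⟫_ℂ = ⟪e c, e c⟫_ℂ := by
      simp only [e, f, Finsupp.linearCombination_apply, Finsupp.sum_inner, Finsupp.inner_sum,
        inner_smul_left, inner_smul_right, hx, inner_charLp]
    rw [inner_self_eq_norm_sq_to_K, inner_self_eq_norm_sq_to_K] at h
    norm_cast at h
    exact (pow_left_inj₀ (norm_nonneg _) (norm_nonneg _) two_ne_zero).1 h
  have hd : DenseRange e := by
    have h := dense_span_charLp τ
    rwa [← Finsupp.range_linearCombination] at h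
  have hIe : ∀ c, f.extendOfNorm e (e c) = f c :=
    LinearMap.extendOfNorm_eq hd ⟨1, fun c => by rw [one_mul, hnorm]⟩
  refine ⟨⟨(f.extendOfNorm e).toLinearMap, fun g => ?_⟩, fun t => ?_⟩
  · refine hd.induction_on (p := fun g => ‖f.extendOfNorm e g‖ = ‖g‖) g
      (isClosed_eq (by fun_prop) (by fun_prop)) fun c => ?_
    rw [hIe, hnorm]
  · have := hIe (Finsupp.single t 1)
    simpa [e, f] using this

variable (τ) in
/-- The indicator function of a measurable set as an element of `L²`. -/
noncomputable def indLp (A : Set (Rd d)) : Lp ℂ 2 τ :=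
  -- The value `0` off the measurable sets matches the convention of `VectorMeasure`.
  open Classical in
  if hA : MeasurableSet A then indicatorConstLp 2 hA (measure_ne_top τ A) 1 else 0

theorem indLp_of_measurableSet {A : Set (Rd d)} (hA : MeasurableSet A) :
    indLp τ A = indicatorConstLp 2 hA (measure_ne_top τ A) 1 := dif_pos hA

theorem coeFn_indLp {A : Set (Rd d)} (hA : MeasurableSet A) :
    indLp τ A =ᵐ[τ] A.indicator fun _ => 1 := by
  rw [indLp_of_measurableSet hA]
  exact indicatorConstLp_coeFn

theorem norm_indLp_sq {A : Set (Rd d)} (hA : MeasurableSet A) : ‖indLp τ A‖ ^ 2 = τ.real A := by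
  rw [indLp_of_measurableSet hA, norm_indicatorConstLp (by simp) (by simp), norm_one, one_mul,
    ← Real.rpow_natCast, ← Real.rpow_mul measureReal_nonneg]
  simp

theorem indLp_union {A B : Set (Rd d)} (hA : MeasurableSet A) (hB : MeasurableSet B)
    (hAB : Disjoint A B) : indLp τ (A ∪ B) = indLp τ A + indLp τ B := by
  rw [indLp_of_measurableSet hA, indLp_of_measurableSet hB, indLp_of_measurableSet (hA.union hB)]
  exact indicatorConstLp_disjoint_union hA hB _ _ hAB 1

/-- Multiplication by a bounded function on `L²`. -/
noncomputable def mulLp {a : Rd d → ℂ} (ha : MemLp a ∞ τ) : Lp ℂ 2 τ →L[ℂ] Lp ℂ 2 τ :=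
  (ContinuousLinearMap.mul ℂ ℂ).holderL τ ∞ 2 2 (ha.toLp a)

omit [IsFiniteMeasure τ] in
theorem coeFn_mulLp {a : Rd d → ℂ} (ha : MemLp a ∞ τ) (f : Lp ℂ 2 τ) :
    mulLp ha f =ᵐ[τ] fun x => a x * f x := by
  filter_upwards [(ContinuousLinearMap.mul ℂ ℂ).coeFn_holder (r := 2) (ha.toLp a) f, ha.coeFn_toLp]
    with x h1 h2
  rw [← h2]
  exact h1

variable (τ) in
/-- Complex conjugation on `L²`. -/
noncomputable def conjLp : Lp ℂ 2 τ →L⋆[ℂ] Lp ℂ 2 τ :=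
  ContinuousLinearMap.compLpL 2 τ (starL ℂ : ℂ ≃L⋆[ℂ] ℂ).toContinuousLinearMap

omit [IsFiniteMeasure τ] in
theorem coeFn_conjLp (f : Lp ℂ 2 τ) : conjLp τ f =ᵐ[τ] fun x => starRingEnd ℂ (f x) :=
  ContinuousLinearMap.coeFn_compLpL _ f

/-- A sesquilinear map on `L²` that is stationary on the characters is supported by the diagonal. -/
theorem indLp_inter_of_stationary {Z : Type*} [NormedAddCommGroup Z] [NormedSpace ℂ Z]
    (B : Lp ℂ 2 τ →L[ℂ] Lp ℂ 2 τ →L⋆[ℂ] Z) {K : Rd d → Z}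
    (hB : ∀ s t, B (charLp τ s) (charLp τ t) = K (s - t)) {A A' : Set (Rd d)}
    (hA : MeasurableSet A) (hA' : MeasurableSet A') :
    B (indLp τ A) (indLp τ A') = B (indLp τ (A ∩ A')) (charLp τ 0) := by
  -- A character moves from the second slot to the first as its conjugate. On characters this is
  -- stationarity; density extends it to every `f`.
  have h1 : ∀ f t, B f (charLp τ t) = B (mulLp (memLp_character τ ∞ (-t)) f) (charLp τ 0) := by
    intro f t
    have h : B.flip (charLp τ t) =
        (B.flip (charLp τ 0)) ∘L mulLp (memLp_character τ ∞ (-t)) := by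
      refine ext_charLp fun s => ?_
      rw [comp_apply, flip_apply, flip_apply, hB]
      have h2 : mulLp (memLp_character τ ∞ (-t)) (charLp τ s) = charLp τ (s - t) := by
        refine Lp.ext ?_
        filter_upwards [coeFn_mulLp (memLp_character τ ∞ (-t)) (charLp τ s), coeFn_charLp τ s,
          coeFn_charLp τ (s - t)] with x h3 h4 h5
        rw [h3, h4, h5, sub_eq_neg_add, character_add]
      rw [h2, hB, sub_zero]
    exact congrArg (fun F => F f) h
  have hAm : MemLp (A.indicator fun _ => (1 : ℂ)) ∞ τ := memLp_indicator_const _ hA _ (by simp)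
  -- Now the second slot is freed: `B (1_A, g) = B (1_A · conj g, 1)`, both sides being
  -- conjugate-linear in `g` and equal on characters.
  have h2 : B (indLp τ A) = ((B.flip (charLp τ 0)) ∘L mulLp hAm).comp (conjLp τ) := by
    refine ext_charLp fun t => ?_
    rw [h1, comp_apply, comp_apply, flip_apply]
    congr 2
    refine Lp.ext ?_
    filter_upwards [coeFn_mulLp (memLp_character τ ∞ (-t)) (indLp τ A), coeFn_indLp (τ := τ) hA,
      coeFn_charLp τ t, coeFn_mulLp hAm (conjLp τ (charLp τ t)), coeFn_conjLp (charLp τ t)]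
      with x h3 h4 h5 h6 h7
    rw [h3, h4, h6, h7, h5, conj_character, mul_comm]
  rw [h2, comp_apply, comp_apply, flip_apply]
  congr 2
  refine Lp.ext ?_
  filter_upwards [coeFn_mulLp hAm (conjLp τ (indLp τ A')), coeFn_conjLp (indLp τ A'),
    coeFn_indLp (τ := τ) hA', coeFn_indLp (τ := τ) (hA.inter hA')] with x h3 h4 h5 h6
  rw [h3, h4, h5, h6]
  by_cases hx : x ∈ A <;> by_cases hx' : x ∈ A' <;> simp [hx, hx']

end Cramer

/-! ### Integrals against operator measures and the control measure -/

namespace Cramer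

section L2

variable {α G : Type*} [MeasurableSpace α] {κ : Measure α} [NormedAddCommGroup G]

theorem lintegral_enorm_sq (f : α → G) : ∫⁻ x, ‖f x‖ₑ ^ 2 ∂κ = eLpNorm f 2 κ ^ 2 := by
  have h := eLpNorm_nnreal_pow_eq_lintegral (μ := κ) (f := f) (p := 2) (by simp)
  simpa using h.symm

theorem tendsto_toLp_iff {ι : Type*} {l : Filter ι} {f : ι → α → G} (hf : ∀ n, MemLp (f n) 2 κ)
    {g : α → G} (hg : MemLp g 2 κ) :
    Tendsto (fun n => (hf n).toLp (f n)) l (𝓝 (hg.toLp g)) ↔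
      Tendsto (fun n => ∫⁻ x, ‖f n x - g x‖ₑ ^ 2 ∂κ) l (𝓝 0) := by
  rw [Lp.tendsto_Lp_iff_tendsto_eLpNorm'']
  have h : ∀ n, ∫⁻ x, ‖f n x - g x‖ₑ ^ 2 ∂κ = eLpNorm (f n - g) 2 κ ^ 2 := fun n =>
    lintegral_enorm_sq (f n - g)
  simp_rw [h]
  constructor
  · intro h1
    simpa [Function.comp_def] using (ENNReal.continuous_pow 2).tendsto _ |>.comp h1
  · intro h1
    have h2 := (ENNReal.continuous_rpow_const (y := (1 / 2 : ℝ))).tendsto _ |>.comp h1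
    have h3 : ∀ x : ℝ≥0∞, (x ^ 2) ^ (1 / 2 : ℝ) = x := fun x => by
      rw [← ENNReal.rpow_natCast, ← ENNReal.rpow_mul]
      norm_num
    simpa [Function.comp_def, -one_div, h3] using h2

end L2

variable {d : ℕ} {V : Type*} [NormedAddCommGroup V] [InnerProductSpace ℂ V] [CompleteSpace V]

open TraceClass

namespace PosOpMeasure

instance (μ : PosOpMeasure d V) : IsFiniteMeasure μ.traceMeasure where
  measure_univ_lt_top := by
    rw [μ.traceMeasure_apply .univ]
    exact enorm_lt_top

theorem ext {μ ν : PosOpMeasure d V}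
    (h : ∀ A, MeasurableSet A → μ.toVectorMeasure A = ν.toVectorMeasure A) : μ = ν := by
  obtain ⟨m, hm⟩ := μ
  obtain ⟨n, hn⟩ := ν
  have : m = n := VectorMeasure.ext h
  subst this
  rfl

theorem norm_toVectorMeasure (μ : PosOpMeasure d V) {A : Set (Rd d)} (hA : MeasurableSet A) :
    ‖μ.toVectorMeasure A‖ = μ.traceMeasure.real A := by
  rw [Measure.real, μ.traceMeasure_apply hA, toReal_enorm]

theorem trace_toVectorMeasure (μ : PosOpMeasure d V) {A : Set (Rd d)} (hA : MeasurableSet A) :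
    trace V (μ.toVectorMeasure A) = (μ.traceMeasure.real A : ℂ) := by
  rw [trace_of_isPositive (μ.isPositive A hA), μ.norm_toVectorMeasure hA]

variable {μ : PosOpMeasure d V} {σ : Measure (Rd d)} [IsFiniteMeasure σ]

omit [IsFiniteMeasure σ] in
theorem integral_congr_ae (h : μ.traceMeasure ≤ σ) {f g : Rd d → ℂ} (hfg : f =ᵐ[σ] g) :
    μ.integral f = μ.integral g := by
  refine VectorMeasure.integral_congr_ae ?_
  rw [μ.variation_eq]
  exact (Measure.absolutelyContinuous_of_le h).ae_eq hfg

theorem integrable_Lp (h : μ.traceMeasure ≤ σ) (f : Lp ℂ 2 σ) : μ.toVectorMeasure.Integrable f := by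
  rw [VectorMeasure.Integrable, μ.variation_eq]
  exact ((Lp.memLp f).integrable (by norm_num)).mono_measure h

theorem integral_smul (c : ℂ) (f : Rd d → ℂ) : μ.integral (c • f) = c • μ.integral f :=
  setToFun_smul _ (fun c A x => by
    change (c * x) • μ.toVectorMeasure A = c • x • μ.toVectorMeasure A
    rw [smul_smul]) c f

theorem integral_indicator_one {A : Set (Rd d)} (hA : MeasurableSet A) :
    μ.integral (A.indicator fun _ => 1) = μ.toVectorMeasure A := by
  have h : μ.toVectorMeasure.variation A ≠ ∞ := by
    rw [μ.variation_eq]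
    exact measure_ne_top _ _
  refine (setToFun_indicator_const (dominatedFinMeasAdditive_cbmApplyMeasure _ _)
    hA h 1).trans ?_
  change (1 : ℂ) • μ.toVectorMeasure A = _
  rw [one_smul]

/-- The integral is controlled by the `L¹` norm for the trace measure, hence by the `L²` norm for
the finite measure `σ`. Allowing `σ` to be larger lets two operator measures be compared on one `L²`
space. -/
theorem norm_integral_le (h : μ.traceMeasure ≤ σ) (f : Lp ℂ 2 σ) :
    ‖μ.integral f‖ ≤ ‖(lsmul ℝ ℂ : ℂ →L[ℝ] TraceClass V →L[ℝ] TraceClass V)‖ *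
      (σ Set.univ ^ (1 / 2 : ℝ)).toReal * ‖f‖ := by
  have h1 : ‖μ.integral f‖ₑ ≤ _ := VectorMeasure.enorm_integral_le_lintegral_enorm
  rw [μ.variation_eq] at h1
  have h2 : ∫⁻ x, ‖f x‖ₑ ∂μ.traceMeasure ≤ ‖f‖ₑ * σ Set.univ ^ (1 / 2 : ℝ) := by
    refine (lintegral_mono' h le_rfl).trans ?_
    rw [← eLpNorm_one_eq_lintegral_enorm, Lp.enorm_def]
    refine (eLpNorm_le_eLpNorm_mul_rpow_measure_univ (p := 1) (q := 2) (by norm_num)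
      (Lp.aestronglyMeasurable f)).trans (le_of_eq ?_)
    norm_num
  have h3 := h1.trans (mul_le_mul_right h2 _)
  have hne : σ Set.univ ^ (1 / 2 : ℝ) ≠ ∞ :=
    ENNReal.rpow_ne_top_of_nonneg (by norm_num) (measure_ne_top _ _)
  have h4 := ENNReal.toReal_mono (by finiteness) h3
  rw [ENNReal.toReal_mul, ENNReal.toReal_mul, toReal_enorm, toReal_enorm, toReal_enorm] at h4
  refine h4.trans (le_of_eq ?_)
  ring

/-- The integral as a continuous linear map on `L²` of a finite measure dominating the trace
measure. -/
noncomputable def integralLp (h : μ.traceMeasure ≤ σ) : Lp ℂ 2 σ →L[ℂ] TraceClass V :=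
  LinearMap.mkContinuous
    { toFun := fun f => μ.integral f
      map_add' := fun f g => by
        rw [integral_congr_ae h (Lp.coeFn_add f g)]
        exact VectorMeasure.integral_add (integrable_Lp h f) (integrable_Lp h g)
      map_smul' := fun c f => by
        rw [integral_congr_ae h (Lp.coeFn_smul c f), integral_smul]
        rfl } _ (norm_integral_le h)

theorem integralLp_apply (h : μ.traceMeasure ≤ σ) (f : Lp ℂ 2 σ) :
    integralLp h f = μ.integral f := rfl

theorem integralLp_charLp (h : μ.traceMeasure ≤ σ) (t : Rd d) :
    integralLp h (charLp σ t) = μ.integral (character t) :=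
  integral_congr_ae h (coeFn_charLp σ t)

theorem integralLp_indLp (h : μ.traceMeasure ≤ σ) {A : Set (Rd d)} (hA : MeasurableSet A) :
    integralLp h (indLp σ A) = μ.toVectorMeasure A := by
  rw [integralLp_apply, integral_congr_ae h (coeFn_indLp hA), integral_indicator_one hA]

/-- A measure with values in the positive trace-class operators is determined by its Fourier
transform. -/
theorem ext_of_integral_character {μ ν : PosOpMeasure d V}
    (h : ∀ t, μ.integral (character t) = ν.integral (character t)) : μ = ν := by
  -- The sum of the trace measures provides a common `L²` space in which the characters are total.
  have hμ : μ.traceMeasure ≤ μ.traceMeasure + ν.traceMeasure := Measure.le_add_right le_rfl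
  have hν : ν.traceMeasure ≤ μ.traceMeasure + ν.traceMeasure := Measure.le_add_left le_rfl
  have heq : integralLp hμ = integralLp hν := ext_charLp fun t => by
    rw [integralLp_charLp, integralLp_charLp, h]
  refine PosOpMeasure.ext fun A hA => ?_
  rw [← integralLp_indLp hμ hA, ← integralLp_indLp hν hA, heq]

end PosOpMeasure

theorem ext_indLp {τ : Measure (Rd d)} [IsFiniteMeasure τ] {Z : Type*} [NormedAddCommGroup Z]
    [NormedSpace ℂ Z] {F G : Lp ℂ 2 τ →L[ℂ] Z}
    (h : ∀ A, MeasurableSet A → F (indLp τ A) = G (indLp τ A)) : F = G := by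
  ext f
  refine Lp.induction (by simp) (motive := fun f => F f = G f) (fun c A hA hτA => ?_)
    (fun f g hf hg _ h1 h2 => by rw [map_add, map_add, h1, h2])
    (isClosed_eq F.continuous G.continuous) f
  have h1 : ((Lp.simpleFunc.indicatorConst 2 hA hτA.ne c : Lp.simpleFunc ℂ 2 τ) : Lp ℂ 2 τ) =
      c • indLp τ A := by
    rw [Lp.simpleFunc.coe_indicatorConst]
    refine Lp.ext ?_
    filter_upwards [indicatorConstLp_coeFn (p := 2) (hs := hA) (hμs := hτA.ne) (c := c),
      Lp.coeFn_smul c (indLp τ A), coeFn_indLp (τ := τ) hA] with x h2 h3 h4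
    rw [h2, h3, Pi.smul_apply, h4]
    by_cases hx : x ∈ A <;> simp [hx]
  rw [h1, map_smul, map_smul, h A hA]

variable {Ω : Type*} [MeasurableSpace Ω] {P : Measure Ω}

/-- The operator-valued control measure of the image of the indicators under an isometry for which
the images of the characters are weakly stationary. -/
theorem exists_posOpMeasure {τ : Measure (Rd d)} [IsFiniteMeasure τ]
    (I : Lp ℂ 2 τ →ₗᵢ[ℂ] Lp V 2 P) {K : Rd d → TraceClass V}
    (hK : ∀ s t, crossCovL V P (I (charLp τ s)) (I (charLp τ t)) = K (s - t)) :
    ∃ μ : PosOpMeasure d V, μ.traceMeasure = τ ∧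
      (∀ A A', MeasurableSet A → MeasurableSet A' → μ.toVectorMeasure (A ∩ A') =
        crossCov P (I (indLp τ A)) (I (indLp τ A'))) ∧
      ∀ t, K t = μ.integral (character t) := by
  let B : Lp ℂ 2 τ →L[ℂ] Lp ℂ 2 τ →L⋆[ℂ] TraceClass V :=
    (crossCovL V P).bilinearComp I.toContinuousLinearMap I.toContinuousLinearMap
  have hBK : ∀ s t, B (charLp τ s) (charLp τ t) = K (s - t) := hK
  have hB : ∀ {A A'}, MeasurableSet A → MeasurableSet A' →
      B (indLp τ A) (indLp τ A') = B (indLp τ (A ∩ A')) (charLp τ 0) := fun hA hA' =>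
    indLp_inter_of_stationary B hBK hA hA'
  -- The diagonal property with `A' = A` rewrites this as the norm of the covariance of `I 1_A` with
  -- itself.
  have hnorm : ∀ A, MeasurableSet A → ‖B (indLp τ A) (charLp τ 0)‖ = τ.real A := fun A hA => by
    have h1 := hB hA hA
    rw [Set.inter_self] at h1
    rw [← h1, ← norm_indLp_sq hA, ← I.norm_map]
    exact norm_crossCovL_self (I (indLp τ A))
  have henorm : ∀ A, MeasurableSet A → ‖B (indLp τ A) (charLp τ 0)‖ₑ = τ A := fun A hA => by
    rw [← ofReal_norm, hnorm A hA, ofReal_measureReal]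
  have hzero : ∀ A, ¬ MeasurableSet A → B (indLp τ A) (charLp τ 0) = 0 := fun A hA => by
    rw [indLp, dif_neg hA, map_zero, zero_apply]
  -- Finite additivity together with domination by `τ` yields countable additivity in the trace
  -- norm.
  let m : VectorMeasure (Rd d) (TraceClass V) :=
    VectorMeasure.of_additive_of_le_measure (μ := τ) (fun A => B (indLp τ A) (charLp τ 0))
      (fun A => by
        by_cases hA : MeasurableSet A
        · exact (henorm A hA).le
        · simp [hzero A hA])
      (fun A A' hA hA' hd => by rw [indLp_union hA hA' hd, map_add, add_apply]) hzero
  let μ : PosOpMeasure d V := ⟨m, fun A hA => by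
    have h1 := hB hA hA
    rw [Set.inter_self] at h1
    change (B (indLp τ A) (charLp τ 0)).op.IsPositive
    rw [← h1]
    exact isPositive_crossCov (Lp.memLp (I (indLp τ A)))⟩
  have hμ : μ.traceMeasure = τ := Measure.ext fun A hA => by
    rw [μ.traceMeasure_apply hA]
    exact henorm A hA
  refine ⟨μ, hμ, fun A A' hA hA' => (hB hA hA').symm, fun t => ?_⟩
  -- Integration against `μ` is `f ↦ B (f, 1)`, since both are continuous and agree on indicators;
  -- at a character this is the spectral formula.
  have h2 : PosOpMeasure.integralLp hμ.le = B.flip (charLp τ 0) := ext_indLp fun A hA => by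
    rw [PosOpMeasure.integralLp_indLp _ hA, flip_apply]
    rfl
  rw [← PosOpMeasure.integralLp_charLp hμ.le, h2, flip_apply, hBK, sub_zero]

end Cramer

/-! ### Stochastic integrals and uniqueness of the random measure -/

namespace Cramer

variable {d : ℕ} {V : Type*} [NormedAddCommGroup V] [InnerProductSpace ℂ V] [CompleteSpace V]
  {Ω : Type*} [MeasurableSpace Ω] {P : Measure Ω}

open TraceClass

theorem toLp_simpleFunc {τ : Measure (Rd d)} [IsFiniteMeasure τ] (ψ : SimpleFunc (Rd d) ℂ)
    (hψ : MemLp ψ 2 τ) : hψ.toLp ψ = ∑ c ∈ ψ.range, c • indLp τ (ψ ⁻¹' {c}) := by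
  refine Lp.ext ?_
  have h1 : ∀ᵐ x ∂τ, ∀ c ∈ ψ.range,
      (c • indLp τ (ψ ⁻¹' {c}) : Lp ℂ 2 τ) x = c * (ψ ⁻¹' {c}).indicator (fun _ => 1) x := by
    refine (Finset.eventually_all _).2 fun c _ => ?_
    filter_upwards [Lp.coeFn_smul c (indLp τ (ψ ⁻¹' {c})),
      coeFn_indLp (τ := τ) (ψ.measurableSet_fiber c)] with x h2 h3
    rw [h2, Pi.smul_apply, h3, smul_eq_mul]
  filter_upwards [hψ.coeFn_toLp, h1,
    Lp.coeFn_finsetSum ψ.range fun c => c • indLp τ (ψ ⁻¹' {c})] with x h2 h3 h4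
  rw [h2, h4, Finset.sum_apply, Finset.sum_congr rfl h3, Finset.sum_eq_single (ψ x)]
  · simp
  · intro c _ hc
    simp [Ne.symm hc]
  · intro h
    exact absurd (ψ.mem_range_self x) h

theorem inner_indLp {τ : Measure (Rd d)} [IsFiniteMeasure τ] {A B : Set (Rd d)}
    (hA : MeasurableSet A) (hB : MeasurableSet B) :
    ⟪indLp τ A, indLp τ B⟫_ℂ = (τ.real (A ∩ B) : ℂ) := by
  rw [indLp_of_measurableSet hA, indLp_of_measurableSet hB]
  exact L2.inner_indicatorConstLp_one_indicatorConstLp_one hA hB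

omit [CompleteSpace V] in
theorem memLp_simpleStochasticIntegral {ξ : Set (Rd d) → Ω → V}
    (hξ : ∀ A, MeasurableSet A → MemLp (ξ A) 2 P) (ψ : SimpleFunc (Rd d) ℂ) :
    MemLp (simpleStochasticIntegral ξ ψ) 2 P :=
  memLp_finsetSum _ fun c _ => (hξ _ (ψ.measurableSet_fiber c)).const_smul c

omit [CompleteSpace V] in
theorem toLp_simpleStochasticIntegral {ξ : Set (Rd d) → Ω → V}
    (hξ : ∀ A, MeasurableSet A → MemLp (ξ A) 2 P) (ψ : SimpleFunc (Rd d) ℂ) :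
    (memLp_simpleStochasticIntegral hξ ψ).toLp _ =
      ∑ c ∈ ψ.range, c • (hξ _ (ψ.measurableSet_fiber c)).toLp (ξ (ψ ⁻¹' {c})) := by
  refine Lp.ext ?_
  have h1 : ∀ᵐ ω ∂P, ∀ c ∈ ψ.range,
      (c • (hξ _ (ψ.measurableSet_fiber c)).toLp (ξ (ψ ⁻¹' {c})) : Lp V 2 P) ω =
        c • ξ (ψ ⁻¹' {c}) ω := by
    refine (Finset.eventually_all _).2 fun c _ => ?_
    filter_upwards [Lp.coeFn_smul c ((hξ _ (ψ.measurableSet_fiber c)).toLp (ξ (ψ ⁻¹' {c}))),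
      (hξ _ (ψ.measurableSet_fiber c)).coeFn_toLp] with ω h2 h3
    rw [h2, Pi.smul_apply, h3]
  filter_upwards [(memLp_simpleStochasticIntegral hξ ψ).coeFn_toLp, h1,
    Lp.coeFn_finsetSum ψ.range
      fun c => c • (hξ _ (ψ.measurableSet_fiber c)).toLp (ξ (ψ ⁻¹' {c}))] with ω h2 h3 h4
  rw [h2, h4, Finset.sum_apply, Finset.sum_congr rfl h3, simpleStochasticIntegral]

theorem exists_simpleFunc_tendsto {τ : Measure (Rd d)} [IsFiniteMeasure τ] {f : Rd d → ℂ}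
    (hf : MemLp f 2 τ) : ∃ ψ : ℕ → SimpleFunc (Rd d) ℂ,
      Tendsto (fun n => ∫⁻ x, ‖ψ n x - f x‖ₑ ^ 2 ∂τ) atTop (𝓝 0) := by
  choose ψ hψ hψm using fun n : ℕ => hf.exists_simpleFunc_eLpNorm_sub_lt (by simp)
    (ε := ((n : ℝ≥0∞) + 1)⁻¹) (by simp)
  refine ⟨ψ, (tendsto_toLp_iff hψm hf).1 ?_⟩
  rw [Lp.tendsto_Lp_iff_tendsto_eLpNorm'']
  refine tendsto_of_tendsto_of_tendsto_of_le_of_le tendsto_const_nhds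
    (h := fun n : ℕ => ((n : ℝ≥0∞) + 1)⁻¹) ?_ (fun _ => zero_le) fun n => ?_
  · have := ENNReal.tendsto_inv_nat_nhds_zero.comp (tendsto_add_atTop_nat 1)
    simpa [Function.comp_def] using this
  · rw [eLpNorm_sub_comm]
    exact (hψ n).le

namespace IsOrthogonalRandomMeasure

variable {ξ : Set (Rd d) → Ω → V} {μ : PosOpMeasure d V}

/-- Taking the trace of the control identity gives the isometry property on indicators. -/
theorem inner_toLp (h : IsOrthogonalRandomMeasure P ξ μ) {A B : Set (Rd d)}
    (hA : MeasurableSet A) (hB : MeasurableSet B) :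
    ⟪(h.isSecondOrder A hA).1.toLp (ξ A), (h.isSecondOrder B hB).1.toLp (ξ B)⟫_ℂ =
      ⟪indLp μ.traceMeasure A, indLp μ.traceMeasure B⟫_ℂ := by
  rw [← trace_crossCovL, crossCovL_toLp, ← h.control B A hB hA,
    μ.trace_toVectorMeasure (hB.inter hA), inner_indLp hA hB, Set.inter_comm]

theorem inner_toLp_stochasticIntegral (h : IsOrthogonalRandomMeasure P ξ μ) {f : Rd d → ℂ}
    {Y : Ω → V} (hY : IsStochasticIntegral P ξ μ f Y) {A : Set (Rd d)} (hA : MeasurableSet A) :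
    ⟪hY.2.1.toLp Y, (h.isSecondOrder A hA).1.toLp (ξ A)⟫_ℂ =
      ⟪hY.1.toLp f, indLp μ.traceMeasure A⟫_ℂ := by
  obtain ⟨hf, hYm, ψ, h1, h2⟩ := hY
  have hξ : ∀ A, MeasurableSet A → MemLp (ξ A) 2 P := fun A hA => (h.isSecondOrder A hA).1
  have hψ : ∀ n, MemLp (ψ n) 2 μ.traceMeasure := fun n => (ψ n).memLp_of_isFiniteMeasure _ _
  have h3 := (tendsto_toLp_iff hψ hf).2 h1
  have h4 := (tendsto_toLp_iff (fun n => memLp_simpleStochasticIntegral hξ (ψ n)) hYm).2 h2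
  refine tendsto_nhds_unique (h4.inner tendsto_const_nhds) ?_
  refine (h3.inner tendsto_const_nhds).congr fun n => ?_
  rw [toLp_simpleStochasticIntegral hξ, toLp_simpleFunc, sum_inner, sum_inner]
  refine Finset.sum_congr rfl fun c _ => ?_
  rw [inner_smul_left, inner_smul_left, h.inner_toLp ((ψ n).measurableSet_fiber c) hA]

end IsOrthogonalRandomMeasure

/-- A random measure representing the images of the characters under an isometry is the image of
the indicators. -/
theorem IsOrthogonalRandomMeasure.ae_eq {μ : PosOpMeasure d V}
    (I : Lp ℂ 2 μ.traceMeasure →ₗᵢ[ℂ] Lp V 2 P) {X : Rd d → Ω → V} (hX : ∀ t, MemLp (X t) 2 P)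
    (hI : ∀ t, I (charLp μ.traceMeasure t) = (hX t).toLp (X t)) {η : Set (Rd d) → Ω → V}
    (hη : IsOrthogonalRandomMeasure P η μ)
    (hηX : ∀ t, IsStochasticIntegral P η μ (character t) (X t)) {A : Set (Rd d)}
    (hA : MeasurableSet A) : η A =ᵐ[P] I (indLp μ.traceMeasure A) := by
  set y : Lp V 2 P := (hη.isSecondOrder A hA).1.toLp (η A)
  set a : Lp ℂ 2 μ.traceMeasure := indLp μ.traceMeasure A
  -- `⟪I f, η A⟫ = ⟪f, 1_A⟫` holds for characters because `η` represents `X`, hence for all `f`; it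
  -- is then used at `f = 1_A`.
  have h1 : (innerSLFlip ℂ y).comp I.toContinuousLinearMap = innerSLFlip ℂ a :=
    ext_charLp fun t => by
      rw [comp_apply, innerSLFlip_apply_apply, innerSLFlip_apply_apply]
      change ⟪I (charLp μ.traceMeasure t), y⟫_ℂ = _
      rw [hI]
      exact hη.inner_toLp_stochasticIntegral (hηX t) hA
  have h2 : ⟪I a, y⟫_ℂ = ⟪a, a⟫_ℂ := congrArg (fun F => F a) h1
  have h3 : ⟪y, y⟫_ℂ = ⟪a, a⟫_ℂ := hη.inner_toLp hA hA
  -- All four inner products in the expansion equal `⟪a, a⟫`.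
  have h4 : ⟪I a - y, I a - y⟫_ℂ = 0 := by
    rw [inner_sub_sub_self, h2, h3, I.inner_map_map, ← inner_conj_symm y, h2, inner_conj_symm]
    ring
  have h5 : y = I a := (sub_eq_zero.1 (inner_self_eq_zero.1 h4)).symm
  rw [← h5]
  exact (MemLp.coeFn_toLp _).symm

/-- Since `P` is finite, pairing the mean with a vector is an `L²` inner product with a constant
function. Thus a zero mean passes from characters to their closed span. -/
theorem integral_eq_zero_of_isometry [IsFiniteMeasure P] {τ : Measure (Rd d)} [IsFiniteMeasure τ]
    (I : Lp ℂ 2 τ →ₗᵢ[ℂ] Lp V 2 P) (h : ∀ t, ∫ ω, I (charLp τ t) ω ∂P = 0) (f : Lp ℂ 2 τ) :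
    ∫ ω, I f ω ∂P = 0 := by
  have hc : ∀ (v : V) (Y : Lp V 2 P),
      ⟪(memLp_const v).toLp (fun _ : Ω => v), Y⟫_ℂ = ⟪v, ∫ ω, Y ω ∂P⟫_ℂ := fun v Y => by
    rw [L2.inner_def, ← integral_inner ((Lp.memLp Y).integrable (by norm_num)) v]
    refine integral_congr_ae ?_
    filter_upwards [(memLp_const (p := 2) (μ := P) v).coeFn_toLp] with ω hω
    rw [hω]
  refine ext_inner_left ℂ fun v => ?_
  have h1 : (innerSL ℂ ((memLp_const v).toLp (fun _ : Ω => v) : Lp V 2 P)).comp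
      I.toContinuousLinearMap = 0 := ext_charLp fun t => by
    rw [comp_apply, innerSL_apply_apply, zero_apply]
    change ⟪_, I (charLp τ t)⟫_ℂ = 0
    rw [hc, h, inner_zero_right]
  rw [← hc, inner_zero_right]
  exact congrArg (fun F => F f) h1

/-- Continuity at the empty set is inherited from the trace measure, because the isometry gives `E‖ξ
A‖² = ‖μ‖_tr A`. -/
theorem isOrthogonalRandomMeasure_of_isometry [IsFiniteMeasure P] {μ : PosOpMeasure d V}
    (I : Lp ℂ 2 μ.traceMeasure →ₗᵢ[ℂ] Lp V 2 P)
    (h0 : ∀ t, ∫ ω, I (charLp μ.traceMeasure t) ω ∂P = 0)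
    (hμ : ∀ A B, MeasurableSet A → MeasurableSet B → μ.toVectorMeasure (A ∩ B) =
      crossCov P (I (indLp μ.traceMeasure A)) (I (indLp μ.traceMeasure B))) :
    IsOrthogonalRandomMeasure P (fun A => I (indLp μ.traceMeasure A)) μ where
  isSecondOrder A _ := ⟨Lp.memLp _, integral_eq_zero_of_isometry I h0 _⟩
  continuity A hA hlim := by
    have h1 : ∀ n, ∫⁻ ω, ‖I (indLp μ.traceMeasure (A n)) ω‖ₑ ^ 2 ∂P = μ.traceMeasure (A n) :=
      fun n => by
        rw [lintegral_enorm_sq, ← Lp.enorm_def, ← ofReal_norm, I.norm_map,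
          ← ENNReal.ofReal_pow (norm_nonneg _), norm_indLp_sq (hA n), ofReal_measureReal]
    simp_rw [h1]
    have h2 := tendsto_measure_of_tendsto_indicator_of_isFiniteMeasure (A := ∅) atTop
      μ.traceMeasure hA fun x => by
        filter_upwards [hlim x] with n hn
        simpa using hn
    simpa using h2
  control := hμ

/-- On simple functions `I` is the elementary stochastic integral, so continuity of `I` carries any
simple approximation of `f` to one of `Y`. -/
theorem isStochasticIntegral_of_isometry {μ : PosOpMeasure d V}
    (I : Lp ℂ 2 μ.traceMeasure →ₗᵢ[ℂ] Lp V 2 P) {f : Rd d → ℂ} (hf : MemLp f 2 μ.traceMeasure)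
    {Y : Ω → V} (hY : MemLp Y 2 P) (hI : I (hf.toLp f) = hY.toLp Y) :
    IsStochasticIntegral P (fun A => I (indLp μ.traceMeasure A)) μ f Y := by
  obtain ⟨ψ, hψ⟩ := exists_simpleFunc_tendsto hf
  have hψm : ∀ n, MemLp (ψ n) 2 μ.traceMeasure := fun n => (ψ n).memLp_of_isFiniteMeasure _ _
  have hξ : ∀ A, MeasurableSet A → MemLp (I (indLp μ.traceMeasure A)) 2 P := fun A _ => Lp.memLp _
  refine ⟨hf, hY, ψ, hψ,
    (tendsto_toLp_iff (fun n => memLp_simpleStochasticIntegral hξ (ψ n)) hY).1 ?_⟩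
  rw [← hI]
  refine ((I.continuous.tendsto _).comp ((tendsto_toLp_iff hψm hf).2 hψ)).congr fun n => ?_
  rw [Function.comp_apply, toLp_simpleStochasticIntegral hξ, toLp_simpleFunc, map_sum]
  refine Finset.sum_congr rfl fun c _ => ?_
  rw [map_smul, Lp.toLp_coeFn]

theorem IsWeaklyStationary.crossCov_eq {X : Rd d → Ω → V} (h : IsWeaklyStationary P X)
    (s t : Rd d) : crossCov P (X s) (X t) = stationaryCov P X (s - t) := by
  -- Shifting the base point from `s` to `s - t` at lag `t - s` brings the second argument to time
  -- `0`.
  have := h.2 s (s - t) (t - s)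
  rwa [add_sub_cancel, sub_add_sub_cancel, sub_self] at this

omit [InnerProductSpace ℂ V] [CompleteSpace V] in
theorem IsL2Continuous.continuous_toLp {X : Rd d → Ω → V} (h : IsL2Continuous P X)
    (hX : ∀ t, MemLp (X t) 2 P) : Continuous fun t => (hX t).toLp (X t) :=
  continuous_iff_continuousAt.2 fun t => (tendsto_toLp_iff hX (hX t)).2 (h t)

end Cramer

/-! ### The spectral representation -/

theorem theorem4p2 {d : ℕ} {V : Type*} [NormedAddCommGroup V] [InnerProductSpace ℂ V]
    [CompleteSpace V] [TopologicalSpace.SeparableSpace V]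
    {Ω : Type*} [MeasurableSpace Ω] (P : Measure Ω) [IsProbabilityMeasure P]
    (X : Cramer.Rd d → Ω → V)
    (hcont : Cramer.IsL2Continuous P X) (hstat : Cramer.IsWeaklyStationary P X) :
    ∃ μ : Cramer.PosOpMeasure d V,
      (∀ t, Cramer.stationaryCov P X t = μ.integral (Cramer.character t)) ∧
      (∀ ν : Cramer.PosOpMeasure d V,
        (∀ t, Cramer.stationaryCov P X t = ν.integral (Cramer.character t)) → ν = μ) ∧
      ∃ ξ : Set (Cramer.Rd d) → Ω → V,
        Cramer.IsOrthogonalRandomMeasure P ξ μ ∧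
        (∀ t, Cramer.IsStochasticIntegral P ξ μ (Cramer.character t) (X t)) ∧
        ∀ η : Set (Cramer.Rd d) → Ω → V,
          Cramer.IsOrthogonalRandomMeasure P η μ →
          (∀ t, Cramer.IsStochasticIntegral P η μ (Cramer.character t) (X t)) →
          ∀ A, MeasurableSet A → η A =ᵐ[P] ξ A := by
  open Cramer in
  have hX : ∀ t, MemLp (X t) 2 P := fun t => (hstat.1 t).1
  have hgram : ∀ s t, ⟪(hX s).toLp (X s), (hX t).toLp (X t)⟫_ℂ =
      TraceClass.trace V (stationaryCov P X (t - s)) := fun s t => by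
    rw [← trace_crossCovL, crossCovL_toLp, hstat.crossCov_eq]
  obtain ⟨τ, hτ, hτX⟩ := exists_charFun_eq
    (φ := fun t => TraceClass.trace V (stationaryCov P X t)) (hcont.continuous_toLp hX) hgram
  obtain ⟨I, hI⟩ := exists_linearIsometry_charLp (τ := τ)
    (x := fun t => (hX t).toLp (X t)) fun s t => by rw [hgram, hτX]
  obtain ⟨μ, hμ, hμξ, hμK⟩ := exists_posOpMeasure I (K := stationaryCov P X) fun s t => by
    rw [hI, hI, crossCovL_toLp, hstat.crossCov_eq]
  subst hμ
  refine ⟨μ, hμK, fun ν hν => PosOpMeasure.ext_of_integral_character fun t => by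
    rw [← hν, hμK], fun A => I (indLp μ.traceMeasure A),
    isOrthogonalRandomMeasure_of_isometry I (fun t => ?_) hμξ,
    fun t => isStochasticIntegral_of_isometry I (memLp_character _ 2 t) (hX t) (hI t),
    fun η hη hηX A hA => hη.ae_eq I hX hI hηX hA⟩
  rw [hI, integral_congr_ae (hX t).coeFn_toLp]
  exact (hstat.1 t).2
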